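/- Let $\delta\in[0,1)$ and let $\lambda:[0,\infty)\to(0,\infty)$ be smooth and non-decreasing, with $\lambda(0)=\lambda_*>0$ and $\ln\lambda$ $\kappa$-Lipschitz for some $\kappa\ge 0$. Consider the TCP process on $\mathbb R_+=[0,\infty)$ with generator $$Lf(x)=f'(x)+\lambda(x)\big(f(\delta x)-f(x)\big),$$ that is, the piecewise deterministic Markov process $(X_t)_{t\ge0}$ which grows at unit speed and, started from $x$, jumps for the first time at a time $T_x$ with $\mathbb P(T_x>s)=e^{-\int_0^s\lambda(x+u)\,du}$, from $x+T_x$ to $\delta(x+T_x)$, and then starts afresh. Let $\mu$ be an invariant probability measure of the process, and let $$h(x)=\int_0^\infty e^{-\int_0^s\lambda(x+u)\,du}\,ds .$$ Then $\mu$ satisfies the Poincaré inequality $\mathcal B(2,c)$ with $$c=\frac{4}{\lambda_*^2}+\frac{32\,\delta^2}{\lambda_*^3(1-\delta^2)\,h\!\left(\frac{2\delta}{\lambda_*(1-\delta)}\right)},$$ that is, for every $f\in C^\infty([0,\infty))$ all of whose derivatives (including $f$ itself) grow at most polynomially at infinity, the integrals below are finite and $$\int f^2\,d\mu-\Big(\int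 f\,d\mu\Big)^2\le c\int (f')^2\,d\mu .$$ -/

import Mathlib

open MeasureTheory ProbabilityTheory Set
open scoped ENNReal NNReal ContDiff

namespace TCP

/-- The cumulated jump rate `Λ_x(t) = ∫₀ᵗ λ(x + u) du` along the flow `t ↦ x + t` started at `x`. -/
noncomputable def cumRate (lam : ℝ → ℝ) (x t : ℝ) : ℝ :=
  ∫ u in (0 : ℝ)..t, lam (x + u)

/-- The first time `t ≥ 0` at which the cumulated jump rate from `x` reaches the level `e`, i.e.
`Λ_x⁻¹(e)`. If `e` is standard exponential this is the jump time `T_x` of the process started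
at `x`: `ℙ(T_x > s) = exp (-Λ_x(s))`. -/
noncomputable def jumpTime (lam : ℝ → ℝ) (x e : ℝ) : ℝ :=
  sInf {t : ℝ | 0 ≤ t ∧ e ≤ cumRate lam x t}

/-- The pair `(S_k, Z_k)` of the `k`-th jump time and the position just after the `k`-th jump, for
the process started at `x` and driven by the sequence of clocks `ξ` (with `S_0 = 0`, `Z_0 = x`).
From `Z_k` the process follows the flow during the time `T = Λ_{Z_k}⁻¹(ξ k)` and then jumps
from `Z_k + T` to `δ (Z_k + T)`. -/
noncomputable def jumpChain (lam : ℝ → ℝ) (δ x : ℝ) (ξ : ℕ → ℝ) : ℕ → ℝ × ℝ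
  | 0 => (0, x)
  | k + 1 =>
    let p := jumpChain lam δ x ξ k
    let T := jumpTime lam p.2 (ξ k)
    (p.1 + T, δ * (p.2 + T))

/-- The number of jumps up to time `t`. -/
noncomputable def jumpCount (lam : ℝ → ℝ) (δ x : ℝ) (ξ : ℕ → ℝ) (t : ℝ) : ℕ :=
  sSup {k : ℕ | (jumpChain lam δ x ξ k).1 ≤ t}

/-- The position `X_t = Z_k + (t - S_k)`, for `S_k ≤ t < S_{k+1}`, of the process at time `t`. -/
noncomputable def position (lam : ℝ → ℝ) (δ : ℝ) (t x : ℝ) (ξ : ℕ → ℝ) : ℝ :=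
  let p := jumpChain lam δ x ξ (jumpCount lam δ x ξ t)
  p.2 + (t - p.1)

/-- The law of the clocks: independent standard exponential variables. -/
noncomputable def clockLaw : Measure (ℕ → ℝ) :=
  Measure.infinitePi fun _ : ℕ => expMeasure 1

/-- The transition semigroup `P_t f (x) = 𝔼 (f (X_t) | X_0 = x)` of the piecewise deterministic
process with generator `L f (x) = f'(x) + λ(x) (f (δ x) - f (x))`, on nonnegative functions. -/
noncomputable def semigroup (lam : ℝ → ℝ) (δ t : ℝ) (f : ℝ → ℝ≥0∞) (x : ℝ) : ℝ≥0∞ :=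
  ∫⁻ ξ, f (position lam δ t x ξ) ∂clockLaw

/-- `μ` is an invariant law of the process on `ℝ₊ = [0, ∞)`: a probability measure carried by
`[0, ∞)` with `μ P_t = μ` for all `t ≥ 0`. -/
structure IsInvariantLaw (lam : ℝ → ℝ) (δ : ℝ) (μ : Measure ℝ) : Prop where
  isProbabilityMeasure : IsProbabilityMeasure μ
  supported : μ (Iio 0) = 0
  invariant : ∀ t : ℝ, 0 ≤ t → ∀ f : ℝ → ℝ≥0∞, Measurable f →
    ∫⁻ x, semigroup lam δ t f x ∂μ = ∫⁻ x, f x ∂μ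

/-- The class `𝒜` of smooth functions on `[0, ∞)` all of whose derivatives (the function itself
included) grow at most polynomially at infinity. -/
def IsTestFunction (f : ℝ → ℝ) : Prop :=
  ContDiffOn ℝ ∞ f (Ici 0) ∧
    ∀ n : ℕ, ∃ (C : ℝ) (k : ℕ), ∀ x : ℝ, 0 ≤ x →
      |iteratedDerivWithin n f (Ici 0) x| ≤ C * (1 + x) ^ k

/-- The Poincaré inequality `𝓑(2, c)` on `[0, ∞)`:
`μ(f²) - (μ f)² ≤ c μ(|f'|²)` for all `f ∈ 𝒜`, all the integrals involved being finite. -/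
def Poincare (μ : Measure ℝ) (c : ℝ) : Prop :=
  ∀ f : ℝ → ℝ, IsTestFunction f →
    Integrable f μ ∧ Integrable (fun x => f x ^ 2) μ ∧
    Integrable (fun x => derivWithin f (Ici 0) x ^ 2) μ ∧
    ∫ x, f x ^ 2 ∂μ - (∫ x, f x ∂μ) ^ 2 ≤ c * ∫ x, derivWithin f (Ici 0) x ^ 2 ∂μ

/-- `h(x) = ∫₀^∞ exp (-∫₀ˢ λ(x + u) du) ds`, the mean of the jump time `T_x`. -/
noncomputable def meanJumpTime (lam : ℝ → ℝ) (x : ℝ) : ℝ :=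
  ∫ s in Ioi (0 : ℝ), Real.exp (-cumRate lam x s)

end TCP

namespace TCP

open Filter Topology

/-! ### Tonelli's theorem on triangles and a weighted Hardy inequality -/

theorem two_mul_mul_le_sq_add_sq (a b : ℝ≥0∞) : 2 * a * b ≤ a ^ 2 + b ^ 2 := by
  rcases eq_or_ne a ⊤ with rfl | ha
  · simp
  rcases eq_or_ne b ⊤ with rfl | hb
  · simp
  lift a to ℝ≥0 using ha
  lift b to ℝ≥0 using hb
  exact_mod_cast two_mul_le_add_sq a b

theorem sq_lintegral_le_lintegral_sq {α : Type*} [MeasurableSpace α] {P : Measure α}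
    [IsProbabilityMeasure P] {f : α → ℝ≥0∞} (hf : Measurable f) (hfin : ∫⁻ x, f x ∂P ≠ ⊤) :
    (∫⁻ x, f x ∂P) ^ 2 ≤ ∫⁻ x, f x ^ 2 ∂P := by
  set a := ∫⁻ x, f x ∂P with ha
  have h : ∫⁻ x, 2 * a * f x ∂P ≤ ∫⁻ x, (a ^ 2 + f x ^ 2) ∂P :=
    lintegral_mono fun x => two_mul_mul_le_sq_add_sq _ _
  rw [lintegral_const_mul _ hf, ← ha, lintegral_add_left measurable_const, lintegral_const,
    measure_univ, mul_one] at h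
  have h2 : 2 * a * a = a ^ 2 + a ^ 2 := by ring
  rw [h2] at h
  exact (ENNReal.add_le_add_iff_left (by finiteness)).1 h

theorem lintegral_Ioi_mul_lintegral_Ioc {q g : ℝ → ℝ≥0∞} (hq : Measurable q) (hg : Measurable g)
    (x : ℝ) :
    ∫⁻ y in Ioi x, q y * ∫⁻ z in Ioc x y, g z = ∫⁻ z in Ioi x, g z * ∫⁻ y in Ioi z, q y := by
  have hs : MeasurableSet {p : ℝ × ℝ | p.2 ≤ p.1} := measurableSet_le measurable_snd measurable_fst
  have h1 : ∀ y, q y * ∫⁻ z in Ioc x y, g z =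
      ∫⁻ z in Ioi x, {p : ℝ × ℝ | p.2 ≤ p.1}.indicator (fun p => q p.1 * g p.2) (y, z) := by
    intro y
    rw [← lintegral_const_mul _ hg, ← Ioi_inter_Iic, inter_comm,
      ← setLIntegral_indicator measurableSet_Iic]
    rfl
  have h2 : ∀ z, x < z → g z * ∫⁻ y in Ioi z, q y =
      ∫⁻ y in Ioi x, {p : ℝ × ℝ | p.2 ≤ p.1}.indicator (fun p => q p.1 * g p.2) (y, z) := by
    intro z hz
    rw [Measure.restrict_congr_set Ioi_ae_eq_Ici, ← lintegral_const_mul _ hq,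
      show Ici z = Ici z ∩ Ioi x from
        (inter_eq_left.2 fun y (hy : z ≤ y) => lt_of_lt_of_le hz hy).symm,
      ← setLIntegral_indicator measurableSet_Ici]
    refine lintegral_congr fun y => ?_
    simp only [indicator, mem_Ici, mem_ofPred_eq, mul_comm]
  rw [setLIntegral_congr_fun measurableSet_Ioi (fun z hz => h2 z hz)]
  simp_rw [h1]
  refine lintegral_lintegral_swap ?_
  exact (((hq.comp measurable_fst).mul (hg.comp measurable_snd)).indicator hs).aemeasurable

theorem measurable_lintegral_Ioc {g : ℝ → ℝ≥0∞} (hg : Measurable g) (x : ℝ) :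
    Measurable fun y => ∫⁻ z in Ioc x y, g z := by
  have hs : MeasurableSet {p : ℝ × ℝ | x < p.2 ∧ p.2 ≤ p.1} :=
    (measurableSet_lt measurable_const measurable_snd).inter
      (measurableSet_le measurable_snd measurable_fst)
  have : ∀ y, ∫⁻ z in Ioc x y, g z =
      ∫⁻ z, {p : ℝ × ℝ | x < p.2 ∧ p.2 ≤ p.1}.indicator (fun p => g p.2) (y, z) := by
    intro y
    rw [← lintegral_indicator measurableSet_Ioc]
    rfl
  simp_rw [this]
  exact ((hg.comp measurable_snd).indicator hs).lintegral_prod_right'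

theorem measurable_lintegral_Ioi {g : ℝ → ℝ≥0∞} (hg : Measurable g) :
    Measurable fun y => ∫⁻ z in Ioi y, g z := by
  have hs : MeasurableSet {p : ℝ × ℝ | p.1 < p.2} := measurableSet_lt measurable_fst measurable_snd
  have : ∀ y, ∫⁻ z in Ioi y, g z =
      ∫⁻ z, {p : ℝ × ℝ | p.1 < p.2}.indicator (fun p => g p.2) (y, z) := by
    intro y
    rw [← lintegral_indicator measurableSet_Ioi]
    rfl
  simp_rw [this]
  exact ((hg.comp measurable_snd).indicator hs).lintegral_prod_right'

theorem sq_lintegral_Ioc_le {g : ℝ → ℝ≥0∞} (hg : Measurable g) (x y : ℝ) :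
    (∫⁻ z in Ioc x y, g z) ^ 2 ≤ 2 * ∫⁻ z in Ioc x y, g z * ∫⁻ w in Ioc x z, g w := by
  have hI := measurable_lintegral_Ioc hg x
  set q : ℝ → ℝ≥0∞ := (Iic y).indicator g with hq
  have hqm : Measurable q := hg.indicator measurableSet_Iic
  have hIoc : ∀ f : ℝ → ℝ≥0∞, ∫⁻ z in Ioc x y, f z = ∫⁻ z in Ioi x, (Iic y).indicator f z := by
    intro f
    rw [setLIntegral_indicator measurableSet_Iic, inter_comm, Ioi_inter_Iic]
  have key := lintegral_Ioi_mul_lintegral_Ioc hqm hqm x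
  have hsplit : ∀ z ∈ Ioi x, ∫⁻ w in Ioi x, q w = (∫⁻ w in Ioc x z, q w) + ∫⁻ w in Ioi z, q w := by
    intro z hz
    rw [← lintegral_union measurableSet_Ioi, Ioc_union_Ioi_eq_Ioi (le_of_lt hz)]
    exact Set.disjoint_left.2 fun w hw hw' => absurd hw.2 (not_le.2 hw')
  have h1 : (∫⁻ z in Ioc x y, g z) ^ 2 = 2 * ∫⁻ z in Ioi x, q z * ∫⁻ w in Ioc x z, q w := by
    rw [hIoc g, sq, ← lintegral_mul_const _ hqm, two_mul]
    nth_rewrite 2 [key]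
    rw [← lintegral_add_left (by have := measurable_lintegral_Ioc hqm x; fun_prop)]
    refine setLIntegral_congr_fun measurableSet_Ioi fun z hz => ?_
    rw [← mul_add, ← hsplit z hz]
  rw [h1, hIoc]
  gcongr with z
  by_cases hz : z ≤ y
  · simp only [hq, indicator, mem_Iic, hz, if_true]
    gcongr with w
    split_ifs <;> simp
  · simp [hq, indicator, hz]

/-- A weighted Hardy inequality: if the tail of the weight `q` is at most `k q`, then the `L²(q)`
norm of a primitive is at most `2 k` times that of its derivative. -/
theorem hardy_inequality {q g : ℝ → ℝ≥0∞} (hq : Measurable q) (hg : Measurable g) (x : ℝ)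
    {k L : ℝ≥0} (hgL : ∀ z, g z ≤ L) (htail : ∀ z, x < z → ∫⁻ y in Ioi z, q y ≤ k * q z)
    (hfin : ∫⁻ y in Ioi x, q y ≠ ⊤) :
    ∫⁻ y in Ioi x, q y * (∫⁻ z in Ioc x y, g z) ^ 2 ≤
      4 * k ^ 2 * ∫⁻ y in Ioi x, q y * g y ^ 2 := by
  have hI := measurable_lintegral_Ioc hg x
  have hA : ∀ f : ℝ → ℝ≥0∞, Measurable f →
      ∫⁻ y in Ioi x, q y * ∫⁻ z in Ioc x y, f z ≤ k * ∫⁻ y in Ioi x, q y * f y := by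
    intro f hf
    rw [lintegral_Ioi_mul_lintegral_Ioc hq hf, ← lintegral_const_mul _ (by fun_prop)]
    refine setLIntegral_mono (measurable_const.mul (hq.mul hf)) fun z hz => ?_
    calc f z * ∫⁻ y in Ioi z, q y ≤ f z * (k * q z) := by gcongr; exact htail z hz
      _ = k * (q z * f z) := by ring
  set I : ℝ → ℝ≥0∞ := fun y => ∫⁻ z in Ioc x y, g z with hIdef
  have h1 : ∫⁻ y in Ioi x, q y * I y ^ 2 ≤ 2 * k * ∫⁻ y in Ioi x, q y * (g y * I y) := by
    calc ∫⁻ y in Ioi x, q y * I y ^ 2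
        ≤ ∫⁻ y in Ioi x, 2 * (q y * ∫⁻ z in Ioc x y, g z * I z) := by
          refine lintegral_mono fun y => ?_
          calc q y * I y ^ 2 ≤ q y * (2 * ∫⁻ z in Ioc x y, g z * I z) := by
                gcongr; exact sq_lintegral_Ioc_le hg x y
            _ = _ := by ring
      _ = 2 * ∫⁻ y in Ioi x, q y * ∫⁻ z in Ioc x y, g z * I z :=
          lintegral_const_mul _ (hq.mul (measurable_lintegral_Ioc (hg.mul hI) x))
      _ ≤ 2 * (k * ∫⁻ y in Ioi x, q y * (g y * I y)) := by gcongr; exact hA _ (hg.mul hI)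
      _ = _ := by ring
  have hfin2 : ∫⁻ y in Ioi x, q y * I y ^ 2 ≠ ⊤ := by
    refine ne_top_of_le_ne_top ?_ h1
    have : ∫⁻ y in Ioi x, q y * (g y * I y) ≤ L * (k * (L * ∫⁻ y in Ioi x, q y)) := by
      calc ∫⁻ y in Ioi x, q y * (g y * I y) ≤ ∫⁻ y in Ioi x, L * (q y * I y) := by
            refine lintegral_mono fun y => ?_
            calc q y * (g y * I y) ≤ q y * (L * I y) := by gcongr; exact hgL y
              _ = _ := by ring
        _ = L * ∫⁻ y in Ioi x, q y * I y := lintegral_const_mul _ (hq.mul hI)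
        _ ≤ L * (k * ∫⁻ y in Ioi x, q y * g y) := by gcongr; exact hA g hg
        _ ≤ L * (k * ∫⁻ y in Ioi x, L * q y) := by
            refine mul_le_mul_right (mul_le_mul_right (lintegral_mono fun y => ?_) _) _
            rw [mul_comm (L : ℝ≥0∞)]
            exact mul_le_mul_right (hgL y) _
        _ = _ := by rw [lintegral_const_mul _ hq]
    refine ENNReal.mul_ne_top (by finiteness) (ne_top_of_le_ne_top ?_ this)
    finiteness
  have h2 : (∫⁻ y in Ioi x, q y * I y ^ 2) + ∫⁻ y in Ioi x, q y * I y ^ 2 ≤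
      (∫⁻ y in Ioi x, q y * I y ^ 2) + 4 * k ^ 2 * ∫⁻ y in Ioi x, q y * g y ^ 2 := by
    calc _ ≤ 2 * (2 * k * ∫⁻ y in Ioi x, q y * (g y * I y)) := by
          rw [← two_mul]; gcongr
      _ = ∫⁻ y in Ioi x, q y * (2 * I y * (2 * k * g y)) := by
          rw [← mul_assoc, ← lintegral_const_mul _ (by fun_prop)]
          refine lintegral_congr fun y => ?_
          ring
      _ ≤ ∫⁻ y in Ioi x, (q y * I y ^ 2 + 4 * k ^ 2 * (q y * g y ^ 2)) := by
          refine lintegral_mono fun y => ?_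
          calc _ ≤ q y * (I y ^ 2 + (2 * k * g y) ^ 2) := by
                gcongr; exact two_mul_mul_le_sq_add_sq _ _
            _ = _ := by ring
      _ = _ := by
          rw [lintegral_add_left (by fun_prop), lintegral_const_mul _ (by fun_prop)]
  exact (ENNReal.add_le_add_iff_left hfin2).1 h2

/-! ### Laws with an increasing hazard rate -/

/-- A continuous non-decreasing rate on the line, bounded below by `c > 0`. -/
structure IsIncreasingRate (r : ℝ → ℝ) (c : ℝ) : Prop where
  pos : 0 < c
  cont : Continuous r
  mono : Monotone r
  le : ∀ x, c ≤ r x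

/-- The survival function `exp (-∫₀ˣ r)` of the rate `r`. -/
noncomputable def survival (r : ℝ → ℝ) (x : ℝ) : ℝ := Real.exp (-∫ u in (0 : ℝ)..x, r u)

theorem survival_pos (r : ℝ → ℝ) (x : ℝ) : 0 < survival r x := Real.exp_pos _

namespace IsIncreasingRate

variable {r : ℝ → ℝ} {c : ℝ} (hr : IsIncreasingRate r c)
include hr

theorem rate_pos (x : ℝ) : 0 < r x := hr.pos.trans_le (hr.le x)

theorem hasDerivAt_survival (x : ℝ) : HasDerivAt (survival r) (-(r x * survival r x)) x := by
  have h : HasDerivAt (fun x => ∫ u in (0 : ℝ)..x, r u) (r x) x :=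
    intervalIntegral.integral_hasDerivAt_right (hr.cont.intervalIntegrable _ _)
      hr.cont.stronglyMeasurable.stronglyMeasurableAtFilter hr.cont.continuousAt
  have h2 : HasDerivAt (survival r) (survival r x * -r x) x := h.neg.exp
  convert h2 using 1
  ring

theorem continuous_survival : Continuous (survival r) :=
  continuous_iff_continuousAt.2 fun x => (hr.hasDerivAt_survival x).continuousAt

theorem tendsto_survival : Tendsto (survival r) atTop (𝓝 0) := by
  refine Real.tendsto_exp_neg_atTop_nhds_zero.comp ?_
  refine tendsto_atTop_mono' atTop ?_ (tendsto_id.const_mul_atTop hr.pos)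
  filter_upwards [eventually_ge_atTop 0] with x hx
  have := intervalIntegral.integral_mono_on hx
    (continuous_const.intervalIntegrable (μ := volume) (u := fun _ : ℝ => c) 0 x) (hr.cont.intervalIntegrable _ _)
    fun u _ => hr.le u
  simpa [mul_comm] using this

end IsIncreasingRate

/-- `γ` is an upper gradient of `F`. -/
def IsUpperGradient (F : ℝ → ℝ) (γ : ℝ → ℝ≥0∞) : Prop :=
  ∀ x y, x ≤ y → ‖F y - F x‖ₑ ≤ ∫⁻ z in Ioc x y, γ z

/-- The density, on `(x, ∞)`, of the law with hazard rate `r` started at `x`. -/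
noncomputable def hazardDensity (r : ℝ → ℝ) (x y : ℝ) : ℝ≥0∞ :=
  (Ioi x).indicator (fun y => ENNReal.ofReal (r y * survival r y / survival r x)) y

/-- The kernel mapping `x` to the law on `(x, ∞)` with hazard rate `r`. -/
noncomputable def hazardKernel (r : ℝ → ℝ) : Kernel ℝ ℝ :=
  Kernel.withDensity (Kernel.const ℝ volume) (hazardDensity r)

theorem memLp_two_of_bounded {α : Type*} [MeasurableSpace α] {P : Measure α} [IsFiniteMeasure P]
    {F : α → ℝ} (hF : Measurable F) {B : ℝ} (hB : ∀ x, |F x| ≤ B) : MemLp F 2 P :=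
  MemLp.of_bound hF.aestronglyMeasurable B (ae_of_all _ hB)

theorem integrable_of_bounded {α : Type*} [MeasurableSpace α] {P : Measure α} [IsFiniteMeasure P]
    {F : α → ℝ} (hF : Measurable F) {B : ℝ} (hB : ∀ x, |F x| ≤ B) : Integrable F P :=
  Integrable.of_bound hF.aestronglyMeasurable B (ae_of_all _ hB)

theorem ofReal_variance_le {α : Type*} [MeasurableSpace α] {P : Measure α} [IsProbabilityMeasure P]
    {F : α → ℝ} (hF : Measurable F) {B : ℝ} (hB : ∀ x, |F x| ≤ B) (a : ℝ) :
    ENNReal.ofReal Var[F; P] ≤ ∫⁻ y, ‖F y - a‖ₑ ^ 2 ∂P := by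
  have hm : Measurable fun y => F y - a := hF.sub_const a
  have hb : ∀ y, |(F y - a) ^ 2| ≤ (B + |a|) ^ 2 := by
    intro y
    rw [abs_pow]
    gcongr
    exact (abs_sub _ _).trans (by gcongr; exact hB y)
  calc ENNReal.ofReal Var[F; P] ≤ ENNReal.ofReal (∫ y, (F y - a) ^ 2 ∂P) := by
        rw [← variance_sub_const hF.aestronglyMeasurable a]
        exact ENNReal.ofReal_le_ofReal (variance_le_expectation_sq hm.aestronglyMeasurable)
    _ = ∫⁻ y, ENNReal.ofReal ((F y - a) ^ 2) ∂P :=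
        ofReal_integral_eq_lintegral_ofReal (integrable_of_bounded (hm.pow_const 2) hb)
          (ae_of_all _ fun y => sq_nonneg _)
    _ = _ := by
        refine lintegral_congr fun y => ?_
        rw [← sq_abs, ENNReal.ofReal_pow (abs_nonneg _), ← Real.enorm_eq_ofReal_abs]

theorem isUpperGradient_of_hasDerivAt {F F' : ℝ → ℝ} {γ : ℝ → ℝ≥0∞}
    (hF : ∀ x, HasDerivAt F (F' x) x) (hF' : Continuous F') (hγ : ∀ x, ‖F' x‖ₑ ≤ γ x) :
    IsUpperGradient F γ := by
  intro x y hxy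
  rw [← intervalIntegral.integral_eq_sub_of_hasDerivAt (fun z _ => hF z)
    (hF'.intervalIntegrable x y), intervalIntegral.integral_of_le hxy]
  exact (enorm_integral_le_lintegral_enorm _).trans (lintegral_mono fun z => hγ z)

namespace IsIncreasingRate

variable {r : ℝ → ℝ} {c : ℝ} (hr : IsIncreasingRate r c)
include hr

theorem integrableOn_rate_mul_survival (x : ℝ) :
    IntegrableOn (fun y => r y * survival r y) (Ioi x) := by
  have := integrableOn_Ioi_deriv_of_nonpos (a := x)
    hr.continuous_survival.continuousAt.continuousWithinAt
    (fun y _ => hr.hasDerivAt_survival y)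
    (fun y _ => neg_nonpos.2 (mul_nonneg (hr.rate_pos y).le (survival_pos r y).le))
    hr.tendsto_survival
  exact (integrable_neg_iff.1 this)

theorem lintegral_rate_mul_survival (x : ℝ) :
    ∫⁻ y in Ioi x, ENNReal.ofReal (r y * survival r y) = ENNReal.ofReal (survival r x) := by
  have := integral_Ioi_of_hasDerivAt_of_nonpos (a := x)
    hr.continuous_survival.continuousAt.continuousWithinAt
    (fun y _ => hr.hasDerivAt_survival y)
    (fun y _ => neg_nonpos.2 (mul_nonneg (hr.rate_pos y).le (survival_pos r y).le))
    hr.tendsto_survival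
  rw [integral_neg, zero_sub, neg_inj] at this
  rw [← this, ofReal_integral_eq_lintegral_ofReal (hr.integrableOn_rate_mul_survival x)]
  exact ae_of_all _ fun y => mul_nonneg (hr.rate_pos y).le (survival_pos r y).le

theorem measurable_hazardDensity : Measurable (Function.uncurry (hazardDensity r)) := by
  have h1 := hr.cont.measurable
  have h2 := hr.continuous_survival.measurable
  have : Measurable fun p : ℝ × ℝ => {p : ℝ × ℝ | p.1 < p.2}.indicator
      (fun p => ENNReal.ofReal (r p.2 * survival r p.2 / survival r p.1)) p :=
    Measurable.indicator (by fun_prop) (measurableSet_lt measurable_fst measurable_snd)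
  exact this

theorem lintegral_hazardKernel (x : ℝ) {g : ℝ → ℝ≥0∞} (hg : Measurable g) :
    ∫⁻ y, g y ∂hazardKernel r x =
      (∫⁻ y in Ioi x, ENNReal.ofReal (r y * survival r y) * g y) / ENNReal.ofReal (survival r x) := by
  rw [hazardKernel, Kernel.lintegral_withDensity _ hr.measurable_hazardDensity _ hg,
    Kernel.const_apply, div_eq_mul_inv, mul_comm _ (_⁻¹)]
  have h1 := hr.cont.measurable
  have h2 := hr.continuous_survival.measurable
  rw [← lintegral_const_mul _ (by fun_prop), ← lintegral_indicator measurableSet_Ioi]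
  refine lintegral_congr fun y => ?_
  by_cases hy : y ∈ Ioi x
  · rw [hazardDensity, indicator_of_mem hy, indicator_of_mem hy, div_eq_mul_inv,
      ENNReal.ofReal_mul (mul_nonneg (hr.rate_pos y).le (survival_pos r y).le),
      ENNReal.ofReal_inv_of_pos (survival_pos r x)]
    ring
  · rw [hazardDensity, indicator_of_notMem hy, indicator_of_notMem hy, zero_mul]

omit hr in
theorem ofReal_survival_ne_zero (x : ℝ) : ENNReal.ofReal (survival r x) ≠ 0 := by
  simpa using survival_pos r x

theorem isMarkovKernel_hazardKernel : IsMarkovKernel (hazardKernel r) := by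
  refine ⟨fun x => ⟨?_⟩⟩
  have := hr.lintegral_hazardKernel x (g := fun _ => 1) measurable_const
  simp only [mul_one, lintegral_one] at this
  rw [this, hr.lintegral_rate_mul_survival, ENNReal.div_self (ofReal_survival_ne_zero x)
    ENNReal.ofReal_ne_top]

theorem hazardKernel_Iic_self (x : ℝ) : hazardKernel r x (Iic x) = 0 := by
  rw [← lintegral_indicator_one measurableSet_Iic,
    hr.lintegral_hazardKernel x (measurable_one.indicator measurableSet_Iic)]
  rw [setLIntegral_congr_fun (g := 0) measurableSet_Ioi]
  · simp
  · intro y hy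
    have hy' : ¬ y ≤ x := not_le.2 hy
    simp [indicator, hy']

theorem lintegral_survival_le (x : ℝ) :
    ∫⁻ y in Ioi x, ENNReal.ofReal (survival r y) ≤
      ENNReal.ofReal (1 / c) * ENNReal.ofReal (survival r x) := by
  have h1 := hr.cont.measurable
  have h2 := hr.continuous_survival.measurable
  rw [← hr.lintegral_rate_mul_survival x, ← lintegral_const_mul _ (by fun_prop)]
  refine lintegral_mono fun y => ?_
  rw [← ENNReal.ofReal_mul (one_div_pos.2 hr.pos).le]
  apply ENNReal.ofReal_le_ofReal
  have := mul_le_mul_of_nonneg_right (hr.le y) (survival_pos r y).le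
  rw [one_div, inv_mul_eq_div, le_div_iff₀ hr.pos]
  linarith

/-- Averages over the primitive of `g` are averages of `g / r`. -/
theorem lintegral_hazardKernel_lintegral_Ioc (x : ℝ) {g : ℝ → ℝ≥0∞} (hg : Measurable g) :
    ∫⁻ y, ∫⁻ z in Ioc x y, g z ∂volume ∂hazardKernel r x =
      (∫⁻ y in Ioi x, ENNReal.ofReal (survival r y) * g y) / ENNReal.ofReal (survival r x) := by
  have h1 := hr.cont.measurable
  have h2 := hr.continuous_survival.measurable
  rw [hr.lintegral_hazardKernel x (measurable_lintegral_Ioc hg x),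
    lintegral_Ioi_mul_lintegral_Ioc (by fun_prop) hg]
  simp_rw [hr.lintegral_rate_mul_survival, mul_comm (g _)]

/-- The Poincaré inequality for the law with hazard rate `r`. -/
theorem ofReal_variance_hazardKernel_le (x : ℝ) {F : ℝ → ℝ} (hF : Measurable F) {B : ℝ}
    (hB : ∀ x, |F x| ≤ B) {γ : ℝ → ℝ≥0∞} (hγ : Measurable γ) {L : ℝ≥0} (hL : ∀ x, γ x ≤ L)
    (h : IsUpperGradient F γ) :
    ENNReal.ofReal Var[F; hazardKernel r x] ≤
      ENNReal.ofReal (4 / c ^ 2) * ∫⁻ y, γ y ^ 2 ∂hazardKernel r x := by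
  have := hr.isMarkovKernel_hazardKernel
  have h1 := hr.cont.measurable
  have h2 := hr.continuous_survival.measurable
  have h3 := measurable_lintegral_Ioc hγ x
  have hmeas : Measurable fun y => ENNReal.ofReal (r y * survival r y) := by fun_prop
  refine (ofReal_variance_le hF hB (F x)).trans ?_
  have hm2 : Measurable fun y => ‖F y - F x‖ₑ ^ 2 := by fun_prop
  rw [hr.lintegral_hazardKernel x hm2, hr.lintegral_hazardKernel x (by fun_prop),
    ← mul_div_assoc]
  refine ENNReal.div_le_div_right ?_ _
  have hk : ENNReal.ofReal (4 / c ^ 2) = 4 * ((1 / c).toNNReal : ℝ≥0∞) ^ 2 := by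
    change _ = 4 * (ENNReal.ofReal (1 / c)) ^ 2
    rw [← ENNReal.ofReal_pow (one_div_pos.2 hr.pos).le, ← ENNReal.ofReal_ofNat 4,
      ← ENNReal.ofReal_mul (by norm_num)]
    congr 1
    rw [one_div, inv_pow, div_eq_mul_inv]
  rw [hk]
  refine le_trans ?_ (hardy_inequality hmeas hγ x hL ?_ ?_)
  · refine setLIntegral_mono' measurableSet_Ioi fun y hy => ?_
    gcongr
    exact h x y (le_of_lt hy)
  · intro z _
    rw [hr.lintegral_rate_mul_survival]
    change _ ≤ ENNReal.ofReal (1 / c) * _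
    rw [← ENNReal.ofReal_mul (one_div_pos.2 hr.pos).le]
    apply ENNReal.ofReal_le_ofReal
    have := mul_le_mul_of_nonneg_right (hr.le z) (survival_pos r z).le
    rw [one_div, inv_mul_eq_div, le_div_iff₀ hr.pos]
    linarith
  · rw [hr.lintegral_rate_mul_survival]
    exact ENNReal.ofReal_ne_top

theorem integral_hazardKernel (x : ℝ) (F : ℝ → ℝ) :
    ∫ y, F y ∂hazardKernel r x = (∫ y in Ioi x, r y * survival r y * F y) / survival r x := by
  have hd : hazardKernel r x = volume.withDensity (hazardDensity r x) := by
    rw [hazardKernel, Kernel.withDensity_apply _ hr.measurable_hazardDensity, Kernel.const_apply]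
  rw [hd, integral_withDensity_eq_integral_toReal_smul
    (hr.measurable_hazardDensity.of_uncurry_left), div_eq_inv_mul, ← integral_const_mul,
    ← integral_indicator measurableSet_Ioi]
  · refine integral_congr_ae (ae_of_all _ fun y => ?_)
    by_cases hy : y ∈ Ioi x
    · simp only [hazardDensity, indicator_of_mem hy, smul_eq_mul]
      rw [ENNReal.toReal_ofReal (div_nonneg (mul_nonneg (hr.rate_pos y).le (survival_pos r y).le)
        (survival_pos r x).le)]
      ring
    · simp [hazardDensity, indicator_of_notMem hy]
  · refine ae_of_all _ fun y => ?_
    by_cases hy : y ∈ Ioi x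
    · simp [hazardDensity, indicator_of_mem hy]
    · simp [hazardDensity, indicator_of_notMem hy]

/-- Averages along the hazard kernel are differentiable. -/
theorem hasDerivAt_integral_hazardKernel {F : ℝ → ℝ} (hF : Continuous F) {B : ℝ}
    (hB : ∀ x, |F x| ≤ B) (x : ℝ) :
    HasDerivAt (fun x => ∫ y, F y ∂hazardKernel r x)
      (r x * (∫ y, F y ∂hazardKernel r x - F x)) x := by
  have hc : Continuous fun y => r y * survival r y * F y :=
    (hr.cont.mul hr.continuous_survival).mul hF
  have hint : ∀ a, IntegrableOn (fun y => r y * survival r y * F y) (Ioi a) := fun a =>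
    (hr.integrableOn_rate_mul_survival a).mul_bdd hF.aestronglyMeasurable
      (ae_of_all _ fun y => by simpa using hB y)
  have heq : (fun x => ∫ y, F y ∂hazardKernel r x) = fun x =>
      ((∫ y in Ioi 0, r y * survival r y * F y) - ∫ y in (0 : ℝ)..x, r y * survival r y * F y)
        / survival r x := by
    funext x
    rw [hr.integral_hazardKernel x F,
      ← intervalIntegral.integral_Ioi_sub_Ioi' (hint 0) (hint x), sub_sub_cancel]
  have hd : HasDerivAt (fun x => ∫ y in (0 : ℝ)..x, r y * survival r y * F y)
      (r x * survival r x * F x) x :=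
    intervalIntegral.integral_hasDerivAt_right (hc.intervalIntegrable _ _)
      hc.stronglyMeasurable.stronglyMeasurableAtFilter hc.continuousAt
  have hd2 := (hd.const_sub (∫ y in Ioi 0, r y * survival r y * F y)).div
    (hr.hasDerivAt_survival x) (survival_pos r x).ne'
  have hx := congrFun heq x
  rw [hx]
  rw [heq]
  refine HasDerivAt.congr_deriv hd2 ?_
  have := (survival_pos r x).ne'
  field_simp
  ring

theorem continuous_integral_hazardKernel {F : ℝ → ℝ} (hF : Continuous F) {B : ℝ}
    (hB : ∀ x, |F x| ≤ B) : Continuous fun x => ∫ y, F y ∂hazardKernel r x :=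
  continuous_iff_continuousAt.2 fun x => (hr.hasDerivAt_integral_hazardKernel hF hB x).continuousAt

/-- The hazard kernel commutes with upper gradients. -/
theorem isUpperGradient_integral_hazardKernel {F : ℝ → ℝ} (hF : Continuous F) {B : ℝ}
    (hB : ∀ x, |F x| ≤ B) {γ : ℝ → ℝ≥0∞} (hγ : Measurable γ) (h : IsUpperGradient F γ) :
    IsUpperGradient (fun x => ∫ y, F y ∂hazardKernel r x)
      (fun x => ∫⁻ y, γ y ∂hazardKernel r x) := by
  have := hr.isMarkovKernel_hazardKernel
  have h1 := hr.cont.measurable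
  have h2 := hr.continuous_survival.measurable
  refine isUpperGradient_of_hasDerivAt (hr.hasDerivAt_integral_hazardKernel hF hB)
    (hr.cont.mul ((hr.continuous_integral_hazardKernel hF hB).sub hF)) fun x => ?_
  rw [enorm_mul]
  have hsub : ∫ y, F y ∂hazardKernel r x - F x = ∫ y, (F y - F x) ∂hazardKernel r x := by
    rw [integral_sub (integrable_of_bounded hF.measurable hB) (integrable_const _)]
    simp
  have hFm := hF.measurable
  calc ‖r x‖ₑ * ‖∫ y, F y ∂hazardKernel r x - F x‖ₑ
      ≤ ‖r x‖ₑ * ∫⁻ y, ‖F y - F x‖ₑ ∂hazardKernel r x := by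
        rw [hsub]; gcongr; exact enorm_integral_le_lintegral_enorm _
    _ ≤ ‖r x‖ₑ * ∫⁻ y, ∫⁻ z in Ioc x y, γ z ∂volume ∂hazardKernel r x := by
        refine mul_le_mul_right (lintegral_mono_ae ?_) _
        have hae : ∀ᵐ y ∂hazardKernel r x, x < y := by
          rw [ae_iff]
          simp only [not_lt]
          exact hr.hazardKernel_Iic_self x
        filter_upwards [hae] with y hy using h x y hy.le
    _ = (∫⁻ y in Ioi x, ENNReal.ofReal (r x) * (ENNReal.ofReal (survival r y) * γ y)) /
          ENNReal.ofReal (survival r x) := by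
        rw [hr.lintegral_hazardKernel_lintegral_Ioc x hγ, lintegral_const_mul _ (by fun_prop),
          mul_div_assoc, Real.enorm_of_nonneg (hr.rate_pos x).le]
    _ ≤ (∫⁻ y in Ioi x, ENNReal.ofReal (r y * survival r y) * γ y) /
          ENNReal.ofReal (survival r x) := by
        refine ENNReal.div_le_div_right (setLIntegral_mono' measurableSet_Ioi fun y hy => ?_) _
        rw [ENNReal.ofReal_mul (hr.rate_pos y).le, mul_assoc]
        gcongr
        exact hr.mono (le_of_lt hy)
    _ = _ := (hr.lintegral_hazardKernel x hγ).symm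

end IsIncreasingRate

/-! ### Poincaré inequalities through kernels -/

/-- The Poincaré inequality with constant `C`, for bounded functions with bounded upper
gradients. -/
def PoincareBounded (P : Measure ℝ) (C : ℝ≥0∞) : Prop :=
  ∀ (F : ℝ → ℝ) (γ : ℝ → ℝ≥0∞) (B : ℝ) (L : ℝ≥0), Continuous F → (∀ x, |F x| ≤ B) →
    Measurable γ → (∀ x, γ x ≤ L) → IsUpperGradient F γ →
    ENNReal.ofReal Var[F; P] ≤ C * ∫⁻ x, γ x ^ 2 ∂P

theorem abs_integral_le_of_bounded {α : Type*} [MeasurableSpace α] {P : Measure α}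
    [IsProbabilityMeasure P] {F : α → ℝ} {B : ℝ} (hB : ∀ x, |F x| ≤ B) : |∫ x, F x ∂P| ≤ B := by
  simpa using norm_integral_le_of_norm_le_const (μ := P) (f := F) (C := B) (ae_of_all _ hB)

section Kernel

variable {α β : Type*} [MeasurableSpace α] [MeasurableSpace β] {K : Kernel α β} [IsMarkovKernel K]
  {ν : Measure α} [IsProbabilityMeasure ν]

theorem integral_bind_of_bounded {F : β → ℝ} (hF : Measurable F) {B : ℝ} (hB : ∀ x, |F x| ≤ B) :
    ∫ y, F y ∂(ν.bind K) = ∫ x, ∫ y, F y ∂K x ∂ν := by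
  rw [← Measure.snd_compProd, Measure.snd,
    integral_map measurable_snd.aemeasurable hF.aestronglyMeasurable,
    Measure.integral_compProd]
  exact integrable_of_bounded (hF.comp measurable_snd) fun p => hB p.2

omit [IsMarkovKernel K] in
theorem measurable_integral_kernel {F : β → ℝ} (hF : Measurable F) :
    Measurable fun x => ∫ y, F y ∂K x :=
  (hF.stronglyMeasurable.integral_kernel (κ := K)).measurable

theorem measurable_variance_kernel {F : β → ℝ} (hF : Measurable F) {B : ℝ}
    (hB : ∀ x, |F x| ≤ B) : Measurable fun x => Var[F; K x] := by
  have : ∀ x, Var[F; K x] = ∫ y, (F ^ 2) y ∂K x - (∫ y, F y ∂K x) ^ 2 := fun x =>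
    variance_eq_sub (memLp_two_of_bounded hF hB)
  simp_rw [this]
  exact (measurable_integral_kernel (K := K) (hF.pow_const 2)).sub
    ((measurable_integral_kernel (K := K) hF).pow_const 2)

/-- The law of total variance. -/
theorem variance_bind {F : β → ℝ} (hF : Measurable F) {B : ℝ} (hB : ∀ x, |F x| ≤ B) :
    Var[F; ν.bind K] = ∫ x, Var[F; K x] ∂ν + Var[fun x => ∫ y, F y ∂K x; ν] := by
  have hB2 : ∀ x, |(F ^ 2) x| ≤ B ^ 2 := fun x => by
    rw [Pi.pow_apply, abs_pow]; gcongr; exact hB x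
  have hKB : ∀ x, |∫ y, F y ∂K x| ≤ B := fun x => abs_integral_le_of_bounded hB
  have hKB2 : ∀ x, |(∫ y, F y ∂K x) ^ 2| ≤ B ^ 2 := fun x => by
    rw [abs_pow]; gcongr; exact hKB x
  have hKm := measurable_integral_kernel (K := K) hF
  have hKm2 := measurable_integral_kernel (K := K) (F := F ^ 2) (hF.pow_const 2)
  rw [variance_eq_sub (memLp_two_of_bounded hF hB),
    variance_eq_sub (memLp_two_of_bounded hKm hKB),
    integral_bind_of_bounded (F := F ^ 2) (hF.pow_const 2) hB2, integral_bind_of_bounded hF hB]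
  have : ∀ x, Var[F; K x] = ∫ y, (F ^ 2) y ∂K x - (∫ y, F y ∂K x) ^ 2 := fun x =>
    variance_eq_sub (memLp_two_of_bounded hF hB)
  simp_rw [this]
  rw [integral_sub (integrable_of_bounded hKm2 fun x => abs_integral_le_of_bounded hB2)
    (integrable_of_bounded (hKm.pow_const 2) hKB2)]
  simp only [Pi.pow_apply]
  ring

theorem ofReal_variance_bind_le {F : β → ℝ} (hF : Measurable F) {B : ℝ} (hB : ∀ x, |F x| ≤ B)
    {C : ℝ≥0∞} {γ : β → ℝ≥0∞} (hγ : Measurable γ)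
    (h : ∀ x, ENNReal.ofReal Var[F; K x] ≤ C * ∫⁻ y, γ y ∂K x) :
    ENNReal.ofReal Var[F; ν.bind K] ≤
      C * ∫⁻ y, γ y ∂(ν.bind K) + ENNReal.ofReal Var[fun x => ∫ y, F y ∂K x; ν] := by
  rw [variance_bind hF hB, ENNReal.ofReal_add (integral_nonneg fun x => variance_nonneg _ _)
    (variance_nonneg _ _), Measure.lintegral_bind K.measurable.aemeasurable hγ.aemeasurable,
    ← lintegral_const_mul _ hγ.lintegral_kernel]
  gcongr
  have hvar : ∀ x, |Var[F; K x]| ≤ B ^ 2 := fun x => by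
    rw [abs_of_nonneg (variance_nonneg _ _)]
    refine (variance_le_expectation_sq hF.aestronglyMeasurable).trans ?_
    refine (le_abs_self _).trans (abs_integral_le_of_bounded fun y => ?_)
    rw [Pi.pow_apply, abs_pow]; gcongr; exact hB y
  rw [ofReal_integral_eq_lintegral_ofReal
    (integrable_of_bounded (measurable_variance_kernel hF hB) hvar)
    (ae_of_all _ fun x => variance_nonneg _ _)]
  exact lintegral_mono h

end Kernel

theorem IsUpperGradient.comp_const_mul {F : ℝ → ℝ} {γ : ℝ → ℝ≥0∞} (h : IsUpperGradient F γ)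
    {δ : ℝ} (hδ : 0 ≤ δ) :
    IsUpperGradient (fun x => F (δ * x)) fun x => ENNReal.ofReal δ * γ (δ * x) := by
  intro x y hxy
  rcases hδ.eq_or_lt with rfl | hδ
  · simp
  refine (h _ _ (mul_le_mul_of_nonneg_left hxy hδ.le)).trans ?_
  have himg : (fun x => δ * x) '' Ioc x y = Ioc (δ * x) (δ * y) := image_mul_left_Ioc hδ x y
  rw [← himg, lintegral_image_eq_lintegral_abs_deriv_mul measurableSet_Ioc (f' := fun _ => δ)
    (fun z _ => by simpa using ((hasDerivAt_id z).const_mul δ).hasDerivWithinAt)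
    (mul_right_injective₀ hδ.ne').injOn, abs_of_pos hδ]

/-- The transition kernel of the positions just after the jumps. -/
noncomputable def jumpKernel (r : ℝ → ℝ) (δ : ℝ) : Kernel ℝ ℝ :=
  (hazardKernel r).map fun y => δ * y

theorem lintegral_jumpKernel (r : ℝ → ℝ) (δ x : ℝ) {g : ℝ → ℝ≥0∞} (hg : Measurable g) :
    ∫⁻ y, g y ∂jumpKernel r δ x = ∫⁻ y, g (δ * y) ∂hazardKernel r x := by
  rw [jumpKernel, Kernel.lintegral_map _ (measurable_const_mul δ) _ hg]

theorem integral_jumpKernel (r : ℝ → ℝ) (δ x : ℝ) {F : ℝ → ℝ} (hF : Measurable F) :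
    ∫ y, F y ∂jumpKernel r δ x = ∫ y, F (δ * y) ∂hazardKernel r x := by
  rw [jumpKernel, Kernel.map_apply _ (measurable_const_mul δ),
    integral_map (measurable_const_mul δ).aemeasurable hF.aestronglyMeasurable]

theorem variance_jumpKernel (r : ℝ → ℝ) (δ x : ℝ) {F : ℝ → ℝ} (hF : Measurable F) :
    Var[F; jumpKernel r δ x] = Var[fun y => F (δ * y); hazardKernel r x] := by
  rw [jumpKernel, Kernel.map_apply _ (measurable_const_mul δ),
    variance_map hF.aemeasurable (measurable_const_mul δ).aemeasurable]
  rfl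

theorem ofReal_variance_le_of_lipschitz {ν : Measure ℝ} [IsProbabilityMeasure ν] {F : ℝ → ℝ}
    {γ : ℝ → ℝ≥0∞} {B : ℝ} {L : ℝ≥0} (hF : Continuous F) (hB : ∀ x, |F x| ≤ B)
    (hL : ∀ x, γ x ≤ L) (h : IsUpperGradient F γ) :
    ENNReal.ofReal Var[F; ν] ≤ ENNReal.ofReal (2 * B) * (L * ∫⁻ x, ‖x‖ₑ ∂ν) := by
  refine (ofReal_variance_le hF.measurable hB (F 0)).trans ?_
  rw [← lintegral_const_mul _ (by fun_prop), ← lintegral_const_mul _ (by fun_prop)]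
  refine lintegral_mono fun x => ?_
  rw [sq]
  refine mul_le_mul' ?_ ?_
  · rw [Real.enorm_eq_ofReal_abs]
    apply ENNReal.ofReal_le_ofReal
    calc |F x - F 0| ≤ |F x| + |F 0| := abs_sub _ _
      _ ≤ 2 * B := by linarith [hB x, hB 0]
  · have key : ∀ u v : ℝ, u ≤ v → ‖F v - F u‖ₑ ≤ L * ‖v - u‖ₑ := by
      intro u v huv
      refine (h u v huv).trans ?_
      calc ∫⁻ z in Ioc u v, γ z ≤ ∫⁻ _ in Ioc u v, (L : ℝ≥0∞) := lintegral_mono fun z => hL z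
        _ = L * ‖v - u‖ₑ := by
          rw [setLIntegral_const, Real.volume_Ioc, Real.enorm_of_nonneg (sub_nonneg.2 huv)]
    rcases le_total 0 x with hx | hx
    · simpa using key 0 x hx
    · have := key x 0 hx
      rwa [zero_sub, enorm_neg, ← neg_sub, enorm_neg] at this

namespace IsIncreasingRate

variable {r : ℝ → ℝ} {c : ℝ} (hr : IsIncreasingRate r c)
include hr

theorem isMarkovKernel_jumpKernel (δ : ℝ) : IsMarkovKernel (jumpKernel r δ) := by
  have := hr.isMarkovKernel_hazardKernel
  exact Kernel.IsMarkovKernel.map _ (measurable_const_mul δ)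

theorem ofReal_variance_le_geometric {δ : ℝ} (hδ : 0 ≤ δ) {ν : Measure ℝ}
    [IsProbabilityMeasure ν] (hν : ν.bind (jumpKernel r δ) = ν) (n : ℕ) :
    ∀ (F : ℝ → ℝ) (γ : ℝ → ℝ≥0∞) (B : ℝ) (L : ℝ≥0), Continuous F → (∀ x, |F x| ≤ B) →
      Measurable γ → (∀ x, γ x ≤ L) → IsUpperGradient F γ →
      ENNReal.ofReal Var[F; ν] ≤
        ENNReal.ofReal (4 * δ ^ 2 / c ^ 2) * (∑ k ∈ Finset.range n, ENNReal.ofReal (δ ^ 2) ^ k) *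
          ∫⁻ x, γ x ^ 2 ∂ν +
        ENNReal.ofReal δ ^ n * (ENNReal.ofReal (2 * B) * (L * ∫⁻ x, ‖x‖ₑ ∂ν)) := by
  have := hr.isMarkovKernel_jumpKernel δ
  have := hr.isMarkovKernel_hazardKernel
  induction n with
  | zero =>
    intro F γ B L hF hB _ hL h
    simpa using ofReal_variance_le_of_lipschitz hF hB hL h
  | succ n ih =>
    intro F γ B L hF hB hγ hL h
    set a := ENNReal.ofReal δ with ha
    set γ' : ℝ → ℝ≥0∞ := fun x => a * γ (δ * x) with hγ'
    have hδ2 : ENNReal.ofReal (δ ^ 2) = a ^ 2 := ENNReal.ofReal_pow hδ 2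
    have h' : IsUpperGradient (fun x => F (δ * x)) γ' := h.comp_const_mul hδ
    have hF' : Continuous fun x => F (δ * x) := by fun_prop
    have hB' : ∀ x, |F (δ * x)| ≤ B := fun x => hB _
    have hγ'm : Measurable γ' := by fun_prop
    have hL' : ∀ x, γ' x ≤ (δ.toNNReal * L : ℝ≥0) := fun x => by
      rw [ENNReal.coe_mul]
      exact mul_le_mul' le_rfl (hL _)
    have hloc : ∀ x, ENNReal.ofReal Var[F; jumpKernel r δ x] ≤
        ENNReal.ofReal (4 * δ ^ 2 / c ^ 2) * ∫⁻ y, γ y ^ 2 ∂jumpKernel r δ x := by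
      intro x
      rw [variance_jumpKernel r δ x hF.measurable,
        lintegral_jumpKernel r δ x (hγ.pow_const 2)]
      refine (hr.ofReal_variance_hazardKernel_le x hF'.measurable hB' hγ'm hL' h').trans_eq ?_
      simp only [hγ', mul_pow]
      rw [lintegral_const_mul _ (by fun_prop), ← mul_assoc, ← hδ2,
        ← ENNReal.ofReal_mul (by have := hr.pos; positivity)]
      congr 2
      ring
    set Fn : ℝ → ℝ := fun x => ∫ y, F (δ * y) ∂hazardKernel r x with hFn
    set γn : ℝ → ℝ≥0∞ := fun x => ∫⁻ y, γ' y ∂hazardKernel r x with hγn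
    have hKF : (fun x => ∫ y, F y ∂jumpKernel r δ x) = Fn := by
      funext x
      exact integral_jumpKernel r δ x hF.measurable
    have hγnm : Measurable γn := hγ'm.lintegral_kernel
    have hγnL : ∀ x, γn x ≤ (δ.toNNReal * L : ℝ≥0) := fun x =>
      (lintegral_mono hL').trans (by simp)
    have ih' := ih Fn γn B (δ.toNNReal * L) (hr.continuous_integral_hazardKernel hF' hB')
      (fun x => abs_integral_le_of_bounded hB') hγnm hγnL
      (hr.isUpperGradient_integral_hazardKernel hF' hB' hγ'm h')
    have hJ : ∫⁻ x, γn x ^ 2 ∂ν ≤ a ^ 2 * ∫⁻ x, γ x ^ 2 ∂ν := by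
      calc ∫⁻ x, γn x ^ 2 ∂ν ≤ ∫⁻ x, a ^ 2 * ∫⁻ y, γ y ^ 2 ∂jumpKernel r δ x ∂ν := by
            refine lintegral_mono fun x => ?_
            refine (sq_lintegral_le_lintegral_sq hγ'm
              (ne_top_of_le_ne_top ENNReal.coe_ne_top (hγnL x))).trans_eq ?_
            rw [lintegral_jumpKernel r δ x (hγ.pow_const 2), ← lintegral_const_mul _ (by fun_prop)]
            simp only [hγ', mul_pow]
        _ = a ^ 2 * ∫⁻ y, γ y ^ 2 ∂(ν.bind (jumpKernel r δ)) := by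
            rw [lintegral_const_mul _ (hγ.pow_const 2).lintegral_kernel,
              Measure.lintegral_bind (jumpKernel r δ).measurable.aemeasurable
                (hγ.pow_const 2).aemeasurable]
        _ = _ := by rw [hν]
    have hstep := ofReal_variance_bind_le (K := jumpKernel r δ) (ν := ν) hF.measurable hB
      (hγ.pow_const 2) hloc
    rw [hν, hKF] at hstep
    refine hstep.trans ((add_le_add_right ih' _).trans ?_)
    rw [← add_assoc]
    refine add_le_add ?_ (le_of_eq ?_)
    · rw [Finset.sum_range_succ', pow_zero]
      rw [hδ2]
      simp only [pow_succ (a ^ 2), ← Finset.sum_mul]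
      calc _ ≤ ENNReal.ofReal (4 * δ ^ 2 / c ^ 2) * ∫⁻ y, γ y ^ 2 ∂ν +
            ENNReal.ofReal (4 * δ ^ 2 / c ^ 2) * (∑ k ∈ Finset.range n, (a ^ 2) ^ k) *
              (a ^ 2 * ∫⁻ x, γ x ^ 2 ∂ν) := by
            gcongr
        _ = _ := by ring
    · rw [ENNReal.coe_mul, pow_succ, ha]
      simp only [ENNReal.ofReal]
      ring

/-- The Poincaré inequality for the invariant law of the chain of the positions after the jumps. -/
theorem poincareBounded_of_invariant {δ : ℝ} (hδ : 0 ≤ δ) (hδ1 : δ < 1) {ν : Measure ℝ}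
    [IsProbabilityMeasure ν] (hν : ν.bind (jumpKernel r δ) = ν) (hm : ∫⁻ x, ‖x‖ₑ ∂ν ≠ ⊤) :
    PoincareBounded ν (ENNReal.ofReal (4 * δ ^ 2 / (c ^ 2 * (1 - δ ^ 2)))) := by
  intro F γ B L hF hB hγ hL h
  have hδ2 : δ ^ 2 < 1 := by nlinarith
  have hgeom : ∀ n, ∑ k ∈ Finset.range n, ENNReal.ofReal (δ ^ 2) ^ k ≤
      ENNReal.ofReal (1 / (1 - δ ^ 2)) := by
    intro n
    refine (ENNReal.sum_le_tsum _).trans ?_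
    rw [ENNReal.tsum_geometric, one_div, ENNReal.ofReal_inv_of_pos (by linarith),
      ENNReal.ofReal_sub _ (sq_nonneg δ), ENNReal.ofReal_one]
  have hC : ENNReal.ofReal (4 * δ ^ 2 / (c ^ 2 * (1 - δ ^ 2))) =
      ENNReal.ofReal (4 * δ ^ 2 / c ^ 2) * ENNReal.ofReal (1 / (1 - δ ^ 2)) := by
    rw [← ENNReal.ofReal_mul (by have := hr.pos; positivity)]
    congr 1
    rw [div_mul_div_comm, mul_one]
  have hlim : Tendsto (fun n : ℕ => ENNReal.ofReal (4 * δ ^ 2 / (c ^ 2 * (1 - δ ^ 2))) *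
        ∫⁻ x, γ x ^ 2 ∂ν +
        ENNReal.ofReal δ ^ n * (ENNReal.ofReal (2 * B) * (L * ∫⁻ x, ‖x‖ₑ ∂ν))) atTop
      (𝓝 (ENNReal.ofReal (4 * δ ^ 2 / (c ^ 2 * (1 - δ ^ 2))) * ∫⁻ x, γ x ^ 2 ∂ν + 0)) := by
    refine Tendsto.add tendsto_const_nhds ?_
    have h0 : Tendsto (fun n : ℕ => ENNReal.ofReal δ ^ n) atTop (𝓝 0) :=
      ENNReal.tendsto_pow_atTop_nhds_zero_of_lt_one (by simpa using hδ1)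
    have := ENNReal.Tendsto.mul_const (b := ENNReal.ofReal (2 * B) * (L * ∫⁻ x, ‖x‖ₑ ∂ν)) h0
      (Or.inr (by finiteness))
    simpa using this
  rw [add_zero] at hlim
  refine ge_of_tendsto' hlim fun n => ?_
  refine (hr.ofReal_variance_le_geometric hδ hν n F γ B L hF hB hγ hL h).trans ?_
  rw [hC]
  gcongr
  exact hgeom n

/-- The Poincaré inequality for a mixture of laws with hazard rate `r`. -/
theorem poincareBounded_bind {ν : Measure ℝ} [IsProbabilityMeasure ν] {C : ℝ≥0∞}
    (hν : PoincareBounded ν C) :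
    PoincareBounded (ν.bind (hazardKernel r)) (ENNReal.ofReal (4 / c ^ 2) + C) := by
  have := hr.isMarkovKernel_hazardKernel
  intro F γ B L hF hB hγ hL h
  have hstep := ofReal_variance_bind_le (K := hazardKernel r) (ν := ν) hF.measurable hB
    (hγ.pow_const 2) fun x => hr.ofReal_variance_hazardKernel_le x hF.measurable hB hγ hL h
  have hγnL : ∀ x, ∫⁻ y, γ y ∂hazardKernel r x ≤ L := fun x =>
      (lintegral_mono hL).trans (by simp)
  refine hstep.trans ?_
  rw [add_mul]
  gcongr
  refine (hν _ _ B L (hr.continuous_integral_hazardKernel hF hB)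
    (fun x => abs_integral_le_of_bounded hB) hγ.lintegral_kernel hγnL
    (hr.isUpperGradient_integral_hazardKernel hF hB hγ h)).trans ?_
  refine mul_le_mul_right ?_ _
  rw [Measure.lintegral_bind (hazardKernel r).measurable.aemeasurable
    (hγ.pow_const 2).aemeasurable]
  exact lintegral_mono fun x => sq_lintegral_le_lintegral_sq hγ
    (ne_top_of_le_ne_top ENNReal.coe_ne_top (hγnL x))

end IsIncreasingRate

/-! ### Perturbation of a Poincaré inequality by a non-increasing density -/

theorem IsUpperGradient.comp_retraction {F : ℝ → ℝ} {γ : ℝ → ℝ≥0∞} (h : IsUpperGradient F γ)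
    {p : ℝ → ℝ} (hp : Monotone p) {A : Set ℝ} (hA : MeasurableSet A)
    (hpA : ∀ x y, x ≤ y → Ioo (p x) (p y) ⊆ Ioc x y ∩ A) (b : ℝ) :
    IsUpperGradient (fun x => F (p x) - b) (A.indicator γ) := by
  intro x y hxy
  rw [sub_sub_sub_cancel_right, setLIntegral_indicator hA, inter_comm]
  refine (h _ _ (hp hxy)).trans ?_
  rw [← Measure.restrict_congr_set Ioo_ae_eq_Ioc]
  exact lintegral_mono_set (hpA x y hxy)

theorem PoincareBounded.lintegral_sq_le {ν : Measure ℝ} [IsProbabilityMeasure ν] {C : ℝ≥0∞}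
    (hν : PoincareBounded ν C) {G : ℝ → ℝ} {γ : ℝ → ℝ≥0∞} {B : ℝ} {L : ℝ≥0} (hG : Continuous G)
    (hB : ∀ x, |G x| ≤ B) (hγ : Measurable γ) (hL : ∀ x, γ x ≤ L) (h : IsUpperGradient G γ)
    {S : Set ℝ} (hS : MeasurableSet S) (hGS : ∀ x, x ∉ S → G x = 0) (hνS : ν.real S ≤ 1 / 2) :
    ∫⁻ x, ‖G x‖ₑ ^ 2 ∂ν ≤ 3 * C * ∫⁻ x, γ x ^ 2 ∂ν := by
  set m := ∫ x, G x ∂ν with hm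
  have hmem : MemLp G 2 ν := memLp_two_of_bounded hG.measurable hB
  have hint2 : Integrable (fun x => G x ^ 2) ν :=
    integrable_of_bounded (hG.measurable.pow_const 2) (B := B ^ 2) fun x => by
      rw [abs_pow]; gcongr; exact hB x
  have hv1 : Var[G; ν] = ∫ x, G x ^ 2 ∂ν - m ^ 2 := variance_eq_sub hmem
  have hv2 : Var[G; ν] = ∫ x, (G x - m) ^ 2 ∂ν := variance_eq_integral hG.aemeasurable
  have hv3 : m ^ 2 * ν.real Sᶜ ≤ Var[G; ν] := by
    rw [hv2]
    refine le_trans (le_of_eq ?_) (setIntegral_le_integral (s := Sᶜ)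
      ((hmem.sub (memLp_const m)).integrable_sq) (ae_of_all _ fun x => sq_nonneg _))
    rw [setIntegral_congr_fun (g := fun _ => m ^ 2) hS.compl fun x hx => by simp [hGS x hx],
      setIntegral_const, smul_eq_mul, mul_comm]
  have hSc : 1 / 2 ≤ ν.real Sᶜ := by
    rw [probReal_compl_eq_one_sub hS]; linarith
  have hle : ∫ x, G x ^ 2 ∂ν ≤ 3 * Var[G; ν] := by nlinarith [sq_nonneg m]
  calc ∫⁻ x, ‖G x‖ₑ ^ 2 ∂ν = ENNReal.ofReal (∫ x, G x ^ 2 ∂ν) := by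
        rw [ofReal_integral_eq_lintegral_ofReal hint2 (ae_of_all _ fun x => sq_nonneg _)]
        refine lintegral_congr fun y => ?_
        rw [← sq_abs, ENNReal.ofReal_pow (abs_nonneg _), ← Real.enorm_eq_ofReal_abs]
    _ ≤ ENNReal.ofReal (3 * Var[G; ν]) := ENNReal.ofReal_le_ofReal hle
    _ = 3 * ENNReal.ofReal Var[G; ν] := by
        rw [ENNReal.ofReal_mul (by norm_num), ENNReal.ofReal_ofNat]
    _ ≤ 3 * (C * ∫⁻ x, γ x ^ 2 ∂ν) := by gcongr; exact hν G γ B L hG hB hγ hL h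
    _ = _ := (mul_assoc _ _ _).symm

theorem PoincareBounded.setLIntegral_sq_le {ν : Measure ℝ} [IsProbabilityMeasure ν] {C : ℝ≥0∞}
    (hν : PoincareBounded ν C) {F : ℝ → ℝ} {γ : ℝ → ℝ≥0∞} {B : ℝ} {L : ℝ≥0} (hF : Continuous F)
    (hB : ∀ x, |F x| ≤ B) (hγ : Measurable γ) (hL : ∀ x, γ x ≤ L) (h : IsUpperGradient F γ)
    {p : ℝ → ℝ} (hp : Monotone p) (hpc : Continuous p) {A S : Set ℝ} (hA : MeasurableSet A)
    (hpA : ∀ x y, x ≤ y → Ioo (p x) (p y) ⊆ Ioc x y ∩ A) {a : ℝ} (hS : MeasurableSet S)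
    (hpS : ∀ x, x ∉ S → p x = a) (hpid : ∀ x ∈ A, p x = x) (hνS : ν.real S ≤ 1 / 2) :
    ∫⁻ x in A, ‖F x - F a‖ₑ ^ 2 ∂ν ≤ 3 * C * ∫⁻ x in A, γ x ^ 2 ∂ν := by
  have hB' : ∀ x, |F (p x) - F a| ≤ B + B := fun x =>
    (abs_sub _ _).trans (add_le_add (hB _) (hB _))
  have hL' : ∀ x, A.indicator γ x ≤ L := fun x => (indicator_le_self _ _ x).trans (hL x)
  have key := hν.lintegral_sq_le (G := fun x => F (p x) - F a) (by fun_prop) hB'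
    (hγ.indicator hA) hL' (h.comp_retraction hp hA hpA (F a)) hS
    (fun x hx => by rw [hpS x hx, sub_self]) hνS
  have hind : ∀ x, A.indicator γ x ^ 2 = A.indicator (fun x => γ x ^ 2) x := fun x => by
    by_cases hx : x ∈ A <;> simp [hx]
  simp_rw [hind] at key
  rw [lintegral_indicator hA] at key
  refine le_trans ?_ key
  rw [← lintegral_indicator hA]
  refine lintegral_mono fun x => ?_
  by_cases hx : x ∈ A
  · simp [hx, hpid x hx]
  · simp [hx]

theorem eq_univ_or_eq_Iio_of_isOpen_of_isLowerSet {D : Set ℝ} (ho : IsOpen D) (hl : IsLowerSet D) :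
    D = ∅ ∨ D = univ ∨ ∃ t, D = Iio t := by
  rcases D.eq_empty_or_nonempty with h | hne
  · exact Or.inl h
  by_cases hu : D = univ
  · exact Or.inr (Or.inl hu)
  obtain ⟨b, hb⟩ := (ne_univ_iff_exists_notMem D).1 hu
  have hbdd : BddAbove D := ⟨b, fun x hx => le_of_not_gt fun hbx => hb (hl hbx.le hx)⟩
  refine Or.inr (Or.inr ⟨sSup D, ?_⟩)
  ext x
  constructor
  · intro hx
    obtain ⟨ε, hε, hball⟩ := Metric.isOpen_iff.1 ho x hx
    have : x + ε / 2 ∈ D := hball (by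
      rw [Metric.mem_ball, Real.dist_eq, add_sub_cancel_left, abs_of_pos (half_pos hε)]
      exact half_lt_self hε)
    exact lt_of_lt_of_le (by linarith) (le_csSup hbdd this)
  · intro hx
    obtain ⟨y, hy, hxy⟩ := exists_lt_of_lt_csSup hne hx
    exact hl hxy.le hy

theorem lintegral_mul_layercake {ν : Measure ℝ} [SFinite ν] {h : ℝ → ℝ} (hh : Measurable h)
    {f : ℝ → ℝ≥0∞} (hf : Measurable f) :
    ∫⁻ x, ENNReal.ofReal (h x) * f x ∂ν = ∫⁻ s in Ioi (0 : ℝ), ∫⁻ x in {x | s < h x}, f x ∂ν := by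
  have hs : MeasurableSet {p : ℝ × ℝ | p.2 < h p.1} :=
    measurableSet_lt measurable_snd (hh.comp measurable_fst)
  have h1 : ∀ x, ENNReal.ofReal (h x) * f x =
      ∫⁻ s in Ioi (0 : ℝ), {p : ℝ × ℝ | p.2 < h p.1}.indicator (fun p => f p.1) (x, s) := by
    intro x
    have : ∀ s, {p : ℝ × ℝ | p.2 < h p.1}.indicator (fun p => f p.1) (x, s) =
        (Iio (h x)).indicator (fun _ => f x) s := fun s => rfl
    simp_rw [this]
    rw [setLIntegral_indicator measurableSet_Iio, setLIntegral_const, inter_comm, Ioi_inter_Iio,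
      Real.volume_Ioo, sub_zero, mul_comm]
  simp_rw [h1]
  rw [lintegral_lintegral_swap]
  · refine lintegral_congr fun s => ?_
    rw [← lintegral_indicator (measurableSet_lt measurable_const hh)]
    rfl
  · exact ((hf.comp measurable_fst).indicator hs).aemeasurable

/-- A Poincaré inequality is stable under multiplication by a bounded non-increasing density,
with a loss controlled by the value of the density at a median. -/
theorem PoincareBounded.withDensity {ν : Measure ℝ} [IsProbabilityMeasure ν] {C : ℝ≥0∞}
    (hν : PoincareBounded ν C) {h : ℝ → ℝ} (hc : Continuous h) (hanti : Antitone h)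
    (hpos : ∀ x, 0 < h x) {b : ℝ} (hb : ∀ x, h x ≤ b) {a : ℝ}
    (ha1 : ν.real (Iio a) ≤ 1 / 2) (ha2 : ν.real (Ioi a) ≤ 1 / 2)
    [IsProbabilityMeasure (ν.withDensity fun x => ENNReal.ofReal (h x))] :
    PoincareBounded (ν.withDensity fun x => ENNReal.ofReal (h x))
      (ENNReal.ofReal (b / h a) * (3 * C)) := by
  intro F γ B L hF hB hγ hL hup
  have hhm := hc.measurable
  have hFm := hF.measurable
  set f : ℝ → ℝ≥0∞ := fun x => ‖F x - F a‖ₑ ^ 2 with hf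
  have hfm : Measurable f := by fun_prop
  have hg : Measurable fun x => γ x ^ 2 := by fun_prop
  have hba : 1 ≤ b / h a := (one_le_div (hpos a)).2 (hb a)
  have hleft : ∫⁻ x in Iic a, ENNReal.ofReal (h x) * f x ∂ν ≤
      ENNReal.ofReal (b / h a) * (3 * C) * ∫⁻ x in Iic a, ENNReal.ofReal (h x) * γ x ^ 2 ∂ν := by
    have key := hν.setLIntegral_sq_le hF hB hγ hL hup (p := fun x => min x a)
      (A := Iic a) (S := Iio a) (a := a) (fun x y hxy => min_le_min_right a hxy) (by fun_prop)
      measurableSet_Iic (fun x y _ z hz => by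
        obtain ⟨h1, h2⟩ := hz
        rcases min_lt_iff.1 h1 with h1 | h1
        · exact ⟨⟨h1, h2.le.trans (min_le_left _ _)⟩, h2.le.trans (min_le_right _ _)⟩
        · exact absurd (h1.trans h2) (not_lt.2 (min_le_right _ _)))
      measurableSet_Iio (fun x hx => min_eq_right (not_lt.1 hx)) (fun x hx => min_eq_left hx) ha1
    calc ∫⁻ x in Iic a, ENNReal.ofReal (h x) * f x ∂ν
        ≤ ∫⁻ x in Iic a, ENNReal.ofReal b * f x ∂ν := by
          gcongr with x; exact hb x
      _ = ENNReal.ofReal b * ∫⁻ x in Iic a, f x ∂ν := lintegral_const_mul _ hfm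
      _ ≤ ENNReal.ofReal b * (3 * C * ∫⁻ x in Iic a, γ x ^ 2 ∂ν) := by gcongr
      _ ≤ ENNReal.ofReal b * (3 * C * ∫⁻ x in Iic a,
            ENNReal.ofReal (1 / h a) * (ENNReal.ofReal (h x) * γ x ^ 2) ∂ν) := by
          refine mul_le_mul_right (mul_le_mul_right
            (setLIntegral_mono' measurableSet_Iic fun x hx => ?_) _) _
          rw [← mul_assoc, ← ENNReal.ofReal_mul (one_div_pos.2 (hpos a)).le]
          refine le_mul_of_one_le_left' ?_
          rw [ENNReal.one_le_ofReal, one_div, inv_mul_eq_div, one_le_div (hpos a)]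
          exact hanti hx
      _ = _ := by
          rw [lintegral_const_mul _ (by fun_prop), div_eq_mul_one_div b,
            ENNReal.ofReal_mul ((hpos a).le.trans (hb a))]
          ring
  have hright : ∫⁻ x in Ioi a, ENNReal.ofReal (h x) * f x ∂ν ≤
      ENNReal.ofReal (b / h a) * (3 * C) * ∫⁻ x in Ioi a, ENNReal.ofReal (h x) * γ x ^ 2 ∂ν := by
    have hkey : ∫⁻ x in Ioi a, ENNReal.ofReal (h x) * f x ∂ν ≤
        3 * C * ∫⁻ x in Ioi a, ENNReal.ofReal (h x) * γ x ^ 2 ∂ν := by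
      rw [lintegral_mul_layercake hhm hfm, lintegral_mul_layercake hhm hg]
      have hmeas : Measurable fun s : ℝ => ∫⁻ x in {x | s < h x}, γ x ^ 2 ∂(ν.restrict (Ioi a)) := by
        have : ∀ s : ℝ, ∫⁻ x in {x | s < h x}, γ x ^ 2 ∂(ν.restrict (Ioi a)) =
            ∫⁻ x, {p : ℝ × ℝ | p.1 < h p.2}.indicator (fun p => γ p.2 ^ 2) (s, x)
              ∂(ν.restrict (Ioi a)) := fun s => by
          rw [← lintegral_indicator (measurableSet_lt measurable_const hhm)]
          rfl
        simp_rw [this]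
        exact (Measurable.indicator (by fun_prop)
          (measurableSet_lt measurable_fst (by fun_prop))).lintegral_prod_right'
      rw [← lintegral_const_mul _ hmeas]
      refine lintegral_mono fun s => ?_
      have hD := eq_univ_or_eq_Iio_of_isOpen_of_isLowerSet (D := {x | s < h x})
        (isOpen_lt continuous_const hc) (fun x y hxy hx => lt_of_lt_of_le hx (hanti hxy))
      rcases hD with hD | hD | ⟨t, hD⟩
      · simp only [hD]; simp
      · simp only [hD, Measure.restrict_univ]
        exact hν.setLIntegral_sq_le hF hB hγ hL hup (p := fun x => max a x)
          (A := Ioi a) (S := Ioi a) (a := a) (fun x y hxy => max_le_max_left a hxy) (by fun_prop)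
          measurableSet_Ioi (fun x y _ z hz => by
            obtain ⟨h1, h2⟩ := hz
            obtain ⟨h1, h1'⟩ := max_lt_iff.1 h1
            rcases lt_max_iff.1 h2 with h2 | h2
            · exact absurd (h1.trans h2) (lt_irrefl _)
            · exact ⟨⟨h1', h2.le⟩, h1⟩)
          measurableSet_Ioi (fun x hx => max_eq_left (not_lt.1 hx))
          (fun x hx => max_eq_right (le_of_lt hx)) ha2
      · simp only [hD]
        rw [Measure.restrict_restrict measurableSet_Iio, inter_comm, Ioi_inter_Iio]
        exact hν.setLIntegral_sq_le hF hB hγ hL hup (p := fun x => max a (min x t))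
          (A := Ioo a t) (S := Ioi a) (a := a)
          (fun x y hxy => max_le_max_left a (min_le_min_right t hxy)) (by fun_prop)
          measurableSet_Ioo (fun x y _ z hz => by
            obtain ⟨h1, h2⟩ := hz
            obtain ⟨h1, h1'⟩ := max_lt_iff.1 h1
            rcases lt_max_iff.1 h2 with h2 | h2
            · exact absurd (h1.trans h2) (lt_irrefl _)
            · obtain ⟨h2, h2'⟩ := lt_min_iff.1 h2
              rcases min_lt_iff.1 h1' with h3 | h3
              · exact ⟨⟨h3, h2.le⟩, h1, h2'⟩
              · exact absurd (h3.trans h2') (lt_irrefl _))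
          measurableSet_Ioi (fun x hx => max_eq_left ((min_le_left _ _).trans (not_lt.1 hx)))
          (fun x hx => by rw [min_eq_left hx.2.le, max_eq_right hx.1.le]) ha2
    refine hkey.trans ?_
    exact mul_le_mul_left (le_mul_of_one_le_left' (ENNReal.one_le_ofReal.2 hba)) _
  refine (ofReal_variance_le hF.measurable hB (F a)).trans ?_
  rw [lintegral_withDensity_eq_lintegral_mul _ (by fun_prop) hfm,
    lintegral_withDensity_eq_lintegral_mul _ (by fun_prop) hg]
  simp only [Pi.mul_apply]
  rw [← lintegral_add_compl _ (measurableSet_Iic (a := a)),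
    ← lintegral_add_compl (fun x => ENNReal.ofReal (h x) * γ x ^ 2) (measurableSet_Iic (a := a)),
    compl_Iic, mul_add]
  exact add_le_add hleft hright

/-! ### The clocks -/

instance : IsProbabilityMeasure (expMeasure 1) := isProbabilityMeasure_expMeasure one_pos

instance : IsProbabilityMeasure clockLaw := by
  unfold clockLaw; infer_instance

theorem expMeasure_one_Iic {a : ℝ} (ha : 0 ≤ a) :
    expMeasure 1 (Iic a) = ENNReal.ofReal (1 - Real.exp (-a)) := by
  rw [← ofReal_cdf, cdf_expMeasure_eq one_pos, if_pos ha, one_mul]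

/-- Prepend a clock to a sequence of clocks. -/
def consClock (p : ℝ × (ℕ → ℝ)) : ℕ → ℝ
  | 0 => p.1
  | n + 1 => p.2 n

theorem measurable_consClock : Measurable consClock := by
  refine measurable_pi_iff.2 fun n => ?_
  cases n with
  | zero => exact measurable_fst
  | succ n => exact (measurable_pi_apply n).comp measurable_snd

theorem map_consClock : ((expMeasure 1).prod clockLaw).map consClock = clockLaw := by
  refine Measure.eq_infinitePi _ fun s t ht => ?_
  classical
  set t' : ℕ → Set ℝ := fun i => if i ∈ s then t i else univ with ht'
  have ht'm : ∀ i, MeasurableSet (t' i) := fun i => by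
    by_cases hi : i ∈ s <;> simp [ht', hi, ht i]
  obtain ⟨N, hN⟩ : ∃ N, s ⊆ Finset.range (N + 1) := by
    obtain ⟨N, hN⟩ := s.exists_nat_subset_range
    exact ⟨N, hN.trans (Finset.range_mono (Nat.le_succ N))⟩
  have hpre : consClock ⁻¹' ((s : Set ℕ).pi t) =
      t' 0 ×ˢ ((Finset.range N : Set ℕ).pi fun i => t' (i + 1)) := by
    ext p
    simp only [mem_preimage, Set.mem_pi, Finset.mem_coe, mem_prod, Finset.mem_range, ht']
    constructor
    · intro h
      refine ⟨?_, fun i _ => ?_⟩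
      · by_cases h0 : 0 ∈ s
        · simpa [h0, consClock] using h 0 h0
        · simp [h0]
      · by_cases h0 : i + 1 ∈ s
        · simpa [h0, consClock] using h (i + 1) h0
        · simp [h0]
    · rintro ⟨h1, h2⟩ i hi
      cases i with
      | zero => simpa [hi, consClock] using h1 
      | succ i =>
        have hlt : i < N := by
          have := Finset.mem_range.1 (hN hi)
          omega
        simpa [hi, consClock] using h2 i hlt
  rw [Measure.map_apply measurable_consClock
    (MeasurableSet.pi (Finset.countable_toSet s) fun i _ => ht i), hpre, Measure.prod_prod,
    clockLaw, Measure.infinitePi_pi _ fun i _ => ht'm _, mul_comm,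
    ← Finset.prod_range_succ' (fun i => expMeasure 1 (t' i))]
  refine (Finset.prod_subset_one_on_sdiff hN (fun i hi => ?_) fun i hi => ?_).symm
  · simp [ht', (Finset.mem_sdiff.1 hi).2]
  · simp [ht', hi]

theorem ae_clockLaw_unbounded : ∀ᵐ ξ ∂clockLaw, ∀ m : ℝ, ∃ k, m < ξ k := by
  have h : ∀ m : ℕ, ∀ᵐ ξ ∂clockLaw, ∃ k, (m : ℝ) < ξ k := by
    intro m
    rw [ae_iff]
    have hq : expMeasure 1 (Iic (m : ℝ)) < 1 := by
      rw [expMeasure_one_Iic m.cast_nonneg, ENNReal.ofReal_lt_one]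
      linarith [Real.exp_pos (-(m : ℝ))]
    have hle : ∀ n : ℕ, clockLaw {ξ | ¬∃ k, (m : ℝ) < ξ k} ≤ expMeasure 1 (Iic (m : ℝ)) ^ n := by
      intro n
      calc clockLaw {ξ | ¬∃ k, (m : ℝ) < ξ k}
          ≤ clockLaw ((Finset.range n : Set ℕ).pi fun _ => Iic (m : ℝ)) := by
            refine measure_mono fun ξ hξ i _ => ?_
            exact not_lt.1 (not_exists.1 hξ i)
        _ = _ := by
            rw [clockLaw, Measure.infinitePi_pi _ fun i _ => measurableSet_Iic]
            simp
    exact le_antisymm (ge_of_tendsto' (ENNReal.tendsto_pow_atTop_nhds_zero_of_lt_one hq) hle)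
      (zero_le)
  filter_upwards [ae_all_iff.2 h] with ξ hξ m
  obtain ⟨n, hn⟩ := exists_nat_ge m
  obtain ⟨k, hk⟩ := hξ n
  exact ⟨k, hn.trans_lt hk⟩

/-- The contribution of the `n`-th inter-jump interval to `f (X_t)`. -/
noncomputable def stay (r : ℝ → ℝ) (δ : ℝ) (f : ℝ → ℝ≥0∞) (n : ℕ) (x : ℝ) (ξ : ℕ → ℝ) (t : ℝ) :
    ℝ≥0∞ :=
  (Ico (jumpChain r δ x ξ n).1 (jumpChain r δ x ξ (n + 1)).1).indicator
    (fun t => f ((jumpChain r δ x ξ n).2 + (t - (jumpChain r δ x ξ n).1))) t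

/-! ### The jump times -/

namespace IsIncreasingRate

variable {r : ℝ → ℝ} {c : ℝ} (hr : IsIncreasingRate r c)
include hr

theorem cumRate_eq (x t : ℝ) :
    cumRate r x t = (∫ u in (0 : ℝ)..x + t, r u) - ∫ u in (0 : ℝ)..x, r u := by
  rw [cumRate, intervalIntegral.integral_comp_add_left (fun u => r u) x, add_zero,
    intervalIntegral.integral_interval_sub_left (hr.cont.intervalIntegrable _ _)
      (hr.cont.intervalIntegrable _ _)]

theorem exp_neg_cumRate (x t : ℝ) :
    Real.exp (-cumRate r x t) = survival r (x + t) / survival r x := by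
  rw [hr.cumRate_eq, survival, survival, ← Real.exp_sub]
  congr 1
  ring

theorem continuous_cumRate : Continuous fun p : ℝ × ℝ => cumRate r p.1 p.2 := by
  have h : Continuous fun x => ∫ u in (0 : ℝ)..x, r u :=
    intervalIntegral.continuous_primitive (fun a b => hr.cont.intervalIntegrable a b) 0
  simp_rw [hr.cumRate_eq]
  exact (h.comp (by fun_prop)).sub (h.comp continuous_fst)

theorem cumRate_sub (x s t : ℝ) : cumRate r x t - cumRate r x s = ∫ u in x + s..x + t, r u := by
  rw [hr.cumRate_eq, hr.cumRate_eq, sub_sub_sub_cancel_right,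
    intervalIntegral.integral_interval_sub_left (hr.cont.intervalIntegrable _ _)
      (hr.cont.intervalIntegrable _ _)]

theorem cumRate_mono (x : ℝ) : Monotone (cumRate r x) := by
  intro s t hst
  rw [← sub_nonneg, hr.cumRate_sub]
  exact intervalIntegral.integral_nonneg (by linarith) fun u _ => (hr.rate_pos u).le

omit hr in
theorem cumRate_zero (x : ℝ) : cumRate r x 0 = 0 := by
  simp [cumRate]

theorem mul_le_cumRate (x : ℝ) {t : ℝ} (ht : 0 ≤ t) : c * t ≤ cumRate r x t := by
  have := intervalIntegral.integral_mono_on ht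
    (continuous_const.intervalIntegrable (μ := volume) (u := fun _ : ℝ => c) 0 t)
    ((hr.cont.comp (continuous_const.add continuous_id)).intervalIntegrable 0 t)
    fun u _ => hr.le (x + u)
  simpa [mul_comm, cumRate] using this

theorem cumRate_le (x : ℝ) {t : ℝ} (ht : 0 ≤ t) : cumRate r x t ≤ r (x + t) * t := by
  have := intervalIntegral.integral_mono_on ht
    ((hr.cont.comp (continuous_const.add continuous_id)).intervalIntegrable 0 t)
    (continuous_const.intervalIntegrable (μ := volume) (u := fun _ : ℝ => r (x + t)) 0 t)
    fun u hu => hr.mono (show x + u ≤ x + t by linarith [hu.2])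
  simpa [mul_comm, cumRate] using this

theorem jumpTime_le_iff (x e t : ℝ) : jumpTime r x e ≤ t ↔ 0 ≤ t ∧ e ≤ cumRate r x t := by
  set A : Set ℝ := {t : ℝ | 0 ≤ t ∧ e ≤ cumRate r x t} with hA
  have hclosed : IsClosed A :=
    (isClosed_le continuous_const continuous_id).inter
      (isClosed_le continuous_const (hr.continuous_cumRate.comp (by fun_prop : Continuous fun t => (x, t))))
  have hbdd : BddBelow A := ⟨0, fun t ht => ht.1⟩
  have hne : A.Nonempty := by
    refine ⟨|e| / c, div_nonneg (abs_nonneg _) hr.pos.le, ?_⟩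
    refine le_trans ?_ (hr.mul_le_cumRate x (div_nonneg (abs_nonneg _) hr.pos.le))
    rw [mul_div_cancel₀ _ hr.pos.ne']
    exact le_abs_self e
  have hmem := hclosed.csInf_mem hne hbdd
  constructor
  · intro h
    exact ⟨hmem.1.trans h, hmem.2.trans (hr.cumRate_mono x h)⟩
  · exact fun h => csInf_le hbdd h

theorem jumpTime_nonneg (x e : ℝ) : 0 ≤ jumpTime r x e := ((hr.jumpTime_le_iff x e _).1 le_rfl).1

theorem le_cumRate_jumpTime (x e : ℝ) : e ≤ cumRate r x (jumpTime r x e) :=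
  ((hr.jumpTime_le_iff x e _).1 le_rfl).2

theorem measurable_jumpTime : Measurable fun p : ℝ × ℝ => jumpTime r p.1 p.2 := by
  refine measurable_of_Iic fun t => ?_
  have : (fun p : ℝ × ℝ => jumpTime r p.1 p.2) ⁻¹' Iic t =
      {p | 0 ≤ t} ∩ {p : ℝ × ℝ | p.2 ≤ cumRate r p.1 t} := by
    ext p
    exact hr.jumpTime_le_iff p.1 p.2 t
  rw [this]
  refine (MeasurableSet.const _).inter (measurableSet_le measurable_snd ?_)
  exact (hr.continuous_cumRate.comp (by fun_prop : Continuous fun p : ℝ × ℝ => (p.1, t))).measurable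

theorem hazardKernel_Iic (x z : ℝ) (hz : x ≤ z) :
    hazardKernel r x (Iic z) = ENNReal.ofReal (1 - survival r z / survival r x) := by
  have := hr.isMarkovKernel_hazardKernel
  have hIoi : hazardKernel r x (Ioi z) = ENNReal.ofReal (survival r z / survival r x) := by
    rw [← lintegral_indicator_one measurableSet_Ioi,
      hr.lintegral_hazardKernel x (measurable_one.indicator measurableSet_Ioi),
      ENNReal.ofReal_div_of_pos (survival_pos r x)]
    congr 1
    have hzx : Ioi z = Ioi z ∩ Ioi x := (inter_eq_left.2 (Ioi_subset_Ioi hz)).symm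
    rw [← hr.lintegral_rate_mul_survival z]
    nth_rewrite 2 [hzx]
    rw [← setLIntegral_indicator measurableSet_Ioi]
    refine lintegral_congr fun y => ?_
    by_cases hy : y ∈ Ioi z
    · simp only [indicator_of_mem hy, Pi.one_apply, mul_one]
    · simp only [indicator_of_notMem hy, mul_zero]
  rw [← compl_Ioi, prob_compl_eq_one_sub measurableSet_Ioi, hIoi,
    ENNReal.ofReal_sub _ (div_nonneg (survival_pos r z).le (survival_pos r x).le),
    ENNReal.ofReal_one]

/-- The position just before the first jump has hazard rate `r`. -/
theorem map_add_jumpTime (x : ℝ) :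
    (expMeasure 1).map (fun e => x + jumpTime r x e) = hazardKernel r x := by
  have := hr.isMarkovKernel_hazardKernel
  have hm : Measurable fun e => x + jumpTime r x e :=
    (hr.measurable_jumpTime.comp measurable_prodMk_left).const_add x
  have := Measure.isFiniteMeasure_map (expMeasure 1) (fun e => x + jumpTime r x e)
  refine Measure.ext_of_Iic _ _ fun z => ?_
  rw [Measure.map_apply hm measurableSet_Iic]
  have hpre : (fun e => x + jumpTime r x e) ⁻¹' Iic z = {e | 0 ≤ z - x ∧ e ≤ cumRate r x (z - x)} := by
    ext e
    rw [mem_preimage, mem_Iic, ← le_sub_iff_add_le', hr.jumpTime_le_iff]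
    rfl
  rw [hpre]
  rcases le_or_gt x z with hz | hz
  · have h0 : 0 ≤ z - x := by linarith
    have h1 : {e | 0 ≤ z - x ∧ e ≤ cumRate r x (z - x)} = Iic (cumRate r x (z - x)) := by
      ext e; simp [h0]
    rw [h1, expMeasure_one_Iic, hr.exp_neg_cumRate, add_sub_cancel, hr.hazardKernel_Iic x z hz]
    rw [← cumRate_zero (r := r) x]
    exact hr.cumRate_mono x h0
  · have h1 : {e | 0 ≤ z - x ∧ e ≤ cumRate r x (z - x)} = ∅ := by
      ext e
      simp only [mem_ofPred_eq, mem_empty_iff_false, iff_false, not_and]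
      intro h; linarith
    rw [h1, measure_empty]
    exact (measure_mono_null (Iic_subset_Iic.2 hz.le) (hr.hazardKernel_Iic_self x)).symm

theorem lintegral_jumpTime (x : ℝ) {φ : ℝ → ℝ≥0∞} (hφ : Measurable φ) :
    ∫⁻ e, φ (x + jumpTime r x e) ∂(expMeasure 1) = ∫⁻ y, φ y ∂hazardKernel r x := by
  rw [← hr.map_add_jumpTime x, lintegral_map hφ]
  exact (hr.measurable_jumpTime.comp measurable_prodMk_left).const_add x

/-! ### The chain of jumps -/

theorem measurable_jumpChain (δ : ℝ) (k : ℕ) :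
    Measurable fun p : ℝ × (ℕ → ℝ) => jumpChain r δ p.1 p.2 k := by
  induction k with
  | zero => exact measurable_const.prodMk measurable_fst
  | succ k ih =>
    have hT : Measurable fun p : ℝ × (ℕ → ℝ) =>
        jumpTime r (jumpChain r δ p.1 p.2 k).2 (p.2 k) :=
      hr.measurable_jumpTime.comp
        ((measurable_snd.comp ih).prodMk ((measurable_pi_apply k).comp measurable_snd))
    exact ((measurable_fst.comp ih).add hT).prodMk (((measurable_snd.comp ih).add hT).const_mul δ)

omit hr in
theorem jumpChain_consClock (δ x e : ℝ) (η : ℕ → ℝ) (k : ℕ) :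
    jumpChain r δ x (consClock (e, η)) (k + 1) =
      (jumpTime r x e + (jumpChain r δ (δ * (x + jumpTime r x e)) η k).1,
        (jumpChain r δ (δ * (x + jumpTime r x e)) η k).2) := by
  induction k with
  | zero => simp [jumpChain, consClock]
  | succ k ih =>
    rw [jumpChain, ih]
    simp [jumpChain, consClock, add_assoc]

theorem jumpChain_fst_mono (δ x : ℝ) (ξ : ℕ → ℝ) : Monotone fun k => (jumpChain r δ x ξ k).1 :=
  monotone_nat_of_le_succ fun _ => le_add_of_nonneg_right (hr.jumpTime_nonneg _ _)

theorem jumpChain_fst_nonneg (δ x : ℝ) (ξ : ℕ → ℝ) (k : ℕ) : 0 ≤ (jumpChain r δ x ξ k).1 :=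
  hr.jumpChain_fst_mono δ x ξ (Nat.zero_le k)

theorem jumpChain_snd_le {δ : ℝ} (hδ0 : 0 ≤ δ) (hδ1 : δ ≤ 1) (x : ℝ) (ξ : ℕ → ℝ) (k : ℕ) :
    (jumpChain r δ x ξ k).2 ≤ max x 0 + (jumpChain r δ x ξ k).1 := by
  induction k with
  | zero => simp [jumpChain]
  | succ k ih =>
    have hT := hr.jumpTime_nonneg (jumpChain r δ x ξ k).2 (ξ k)
    have hS := hr.jumpChain_fst_nonneg δ x ξ k
    have h0 : 0 ≤ max x 0 := le_max_right _ _
    simp only [jumpChain]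
    set T := jumpTime r (jumpChain r δ x ξ k).2 (ξ k)
    rcases le_total 0 ((jumpChain r δ x ξ k).2 + T) with h | h
    · nlinarith
    · nlinarith

theorem exists_lt_jumpChain {δ : ℝ} (hδ0 : 0 ≤ δ) (hδ1 : δ ≤ 1) (x : ℝ) {ξ : ℕ → ℝ}
    (hξ : ∀ m : ℝ, ∃ k, m < ξ k) (t : ℝ) : ∃ n, t < (jumpChain r δ x ξ n).1 := by
  by_contra! hcon
  obtain ⟨k, hk⟩ := hξ (r (max x 0 + t) * t)
  refine absurd hk (not_lt.2 ?_)
  have hT := hr.jumpTime_nonneg (jumpChain r δ x ξ k).2 (ξ k)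
  have hS := hr.jumpChain_fst_nonneg δ x ξ k
  have hZ := hr.jumpChain_snd_le hδ0 hδ1 x ξ k
  have h1 := hcon (k + 1)
  have h2 := hr.le_cumRate_jumpTime (jumpChain r δ x ξ k).2 (ξ k)
  have h3 := hr.cumRate_le (jumpChain r δ x ξ k).2 hT
  simp only [jumpChain] at h1
  refine (h2.trans h3).trans (mul_le_mul (hr.mono (by linarith)) (by linarith) hT
    (hr.rate_pos _).le)

theorem position_eq_tsum {δ x t : ℝ} (ht : 0 ≤ t) {ξ : ℕ → ℝ}
    (hξ : ∃ n, t < (jumpChain r δ x ξ n).1) (f : ℝ → ℝ≥0∞) :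
    f (position r δ t x ξ) = ∑' n, stay r δ f n x ξ t := by
  classical
  have hmono := hr.jumpChain_fst_mono δ x ξ
  obtain ⟨n, hn, hmin⟩ : ∃ n, t < (jumpChain r δ x ξ n).1 ∧
      ∀ m < n, (jumpChain r δ x ξ m).1 ≤ t :=
    ⟨Nat.find hξ, Nat.find_spec hξ, fun m hm => not_lt.1 (Nat.find_min hξ hm)⟩
  obtain ⟨n, rfl⟩ : ∃ m, n = m + 1 := by
    refine Nat.exists_eq_succ_of_ne_zero ?_
    rintro rfl
    simp only [jumpChain] at hn
    linarith
  have hcount : jumpCount r δ x ξ t = n := by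
    have : {k : ℕ | (jumpChain r δ x ξ k).1 ≤ t} = Iic n := by
      ext k
      simp only [mem_ofPred_eq, mem_Iic]
      refine ⟨fun hk => ?_, fun hk => hmin k (Nat.lt_succ_of_le hk)⟩
      by_contra hlt
      exact absurd (lt_of_lt_of_le hn (hmono (Nat.succ_le_of_lt (not_le.1 hlt)))) (not_lt.2 hk)
    rw [jumpCount, this, csSup_Iic]
  rw [tsum_eq_single n]
  · rw [stay, indicator_of_mem (show t ∈ Ico _ _ from ⟨hmin n (Nat.lt_succ_self n), hn⟩),
      position, hcount]
  · intro m hm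
    rw [stay, indicator_of_notMem]
    rintro ⟨h1, h2⟩
    rcases lt_or_gt_of_ne hm with h | h
    · exact absurd (h2.trans_le (hmono (Nat.succ_le_of_lt h))) (not_lt.2 (hmin n (Nat.lt_succ_self n)))
    · exact absurd (hn.trans_le (hmono (Nat.succ_le_of_lt h))) (not_lt.2 h1)

theorem measurable_stay (δ : ℝ) {f : ℝ → ℝ≥0∞} (hf : Measurable f) (n : ℕ) :
    Measurable fun p : ℝ × ℝ × (ℕ → ℝ) => stay r δ f n p.2.1 p.2.2 p.1 := by
  have h1 : ∀ k, Measurable fun p : ℝ × ℝ × (ℕ → ℝ) => jumpChain r δ p.2.1 p.2.2 k :=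
    fun k => (hr.measurable_jumpChain δ k).comp measurable_snd
  have hs : MeasurableSet {p : ℝ × ℝ × (ℕ → ℝ) | (jumpChain r δ p.2.1 p.2.2 n).1 ≤ p.1 ∧
      p.1 < (jumpChain r δ p.2.1 p.2.2 (n + 1)).1} :=
    (measurableSet_le (measurable_fst.comp (h1 n)) measurable_fst).inter
      (measurableSet_lt measurable_fst (measurable_fst.comp (h1 (n + 1))))
  have hg : Measurable fun p : ℝ × ℝ × (ℕ → ℝ) =>
      f ((jumpChain r δ p.2.1 p.2.2 n).2 + (p.1 - (jumpChain r δ p.2.1 p.2.2 n).1)) :=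
    hf.comp ((measurable_snd.comp (h1 n)).add
      (measurable_fst.sub (measurable_fst.comp (h1 n))))
  exact hg.indicator hs

theorem semigroup_eq {δ : ℝ} (hδ0 : 0 ≤ δ) (hδ1 : δ ≤ 1) {t : ℝ} (ht : 0 ≤ t) (f : ℝ → ℝ≥0∞)
    (x : ℝ) : semigroup r δ t f x = ∫⁻ ξ, ∑' n, stay r δ f n x ξ t ∂clockLaw := by
  refine lintegral_congr_ae ?_
  filter_upwards [ae_clockLaw_unbounded] with ξ hξ
  exact hr.position_eq_tsum ht (hr.exists_lt_jumpChain hδ0 hδ1 x hξ t) f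

end IsIncreasingRate

/-! ### Potentials -/

/-- The mean occupation of `g` along the flow from `x` before the first jump. -/
noncomputable def potential (r : ℝ → ℝ) (g : ℝ → ℝ≥0∞) (x : ℝ) : ℝ≥0∞ :=
  (∫⁻ y in Ioi x, ENNReal.ofReal (survival r y) * g y) / ENNReal.ofReal (survival r x)

/-- The mean occupation, discounted at rate one, of `g` along the flow from `x` before the first
jump. -/
noncomputable def discountedPotential (r : ℝ → ℝ) (g : ℝ → ℝ≥0∞) (x : ℝ) : ℝ≥0∞ :=
  potential r (fun y => ENNReal.ofReal (Real.exp (-(y - x))) * g y) x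

/-- The discounted operator `φ ↦ 𝔼 (exp (-T_x) φ (δ (x + T_x)))`. -/
noncomputable def discountedJump (r : ℝ → ℝ) (δ : ℝ) (φ : ℝ → ℝ≥0∞) (x : ℝ) : ℝ≥0∞ :=
  ∫⁻ y, ENNReal.ofReal (Real.exp (-(y - x))) * φ (δ * y) ∂hazardKernel r x

/-- The discounted occupation of `f` during the `n`-th inter-jump interval. -/
noncomputable def occupation (r : ℝ → ℝ) (δ : ℝ) (f : ℝ → ℝ≥0∞) (n : ℕ) (x : ℝ) : ℝ≥0∞ :=
  ∫⁻ ξ, ∫⁻ t, ENNReal.ofReal (Real.exp (-t)) * stay r δ f n x ξ t ∂volume ∂clockLaw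

theorem lintegral_Ici_exp_neg : ∫⁻ t in Ici (0 : ℝ), ENNReal.ofReal (Real.exp (-t)) = 1 := by
  rw [← Measure.restrict_congr_set Ioi_ae_eq_Ici,
    ← ofReal_integral_eq_lintegral_ofReal (integrableOn_exp_neg_Ioi 0)
      (ae_of_all _ fun t => (Real.exp_pos _).le), integral_exp_neg_Ioi_zero, ENNReal.ofReal_one]

theorem lintegral_Ioc_exp_neg {x z : ℝ} (hxz : x ≤ z) :
    ∫⁻ y in Ioc x z, ENNReal.ofReal (Real.exp (-(y - x))) =
      ENNReal.ofReal (1 - Real.exp (-(z - x))) := by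
  have hc : Continuous fun y => Real.exp (-(y - x)) := by fun_prop
  rw [← ofReal_integral_eq_lintegral_ofReal
    ((hc.integrableOn_Icc).mono_set Ioc_subset_Icc_self)
    (ae_of_all _ fun y => (Real.exp_pos _).le), ← intervalIntegral.integral_of_le hxz]
  congr 1
  have hd : ∀ y ∈ uIcc x z, HasDerivAt (fun y => -Real.exp (-(y - x))) (Real.exp (-(y - x))) y := by
    intro y _
    have := (((hasDerivAt_id y).sub_const x).neg.exp).neg
    exact this.congr_deriv (by simp)
  rw [intervalIntegral.integral_eq_sub_of_hasDerivAt hd (hc.intervalIntegrable _ _)]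
  simp
  ring

namespace IsIncreasingRate

variable {r : ℝ → ℝ} {c : ℝ} (hr : IsIncreasingRate r c)
include hr

theorem measurable_potential {g : ℝ → ℝ≥0∞} (hg : Measurable g) : Measurable (potential r g) := by
  have h2 := hr.continuous_survival.measurable
  have h3 : Measurable fun x => ∫⁻ y in Ioi x, ENNReal.ofReal (survival r y) * g y :=
    measurable_lintegral_Ioi (by fun_prop)
  exact h3.div (by fun_prop)

/-- The weight `r` turns potentials into averages along the hazard kernel. -/
theorem potential_rate_mul (x : ℝ) {g : ℝ → ℝ≥0∞} (hg : Measurable g) :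
    potential r (fun y => ENNReal.ofReal (r y) * g y) x = ∫⁻ y, g y ∂hazardKernel r x := by
  rw [hr.lintegral_hazardKernel x hg, potential]
  congr 1
  refine lintegral_congr fun y => ?_
  rw [ENNReal.ofReal_mul (hr.rate_pos y).le]
  ring

theorem discountedPotential_rate_mul (δ x : ℝ) {φ : ℝ → ℝ≥0∞} (hφ : Measurable φ) :
    discountedPotential r (fun y => ENNReal.ofReal (r y) * φ (δ * y)) x =
      discountedJump r δ φ x := by
  rw [discountedPotential, discountedJump, ← hr.potential_rate_mul x (by fun_prop)]
  congr 1
  funext y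
  ring

theorem discountedPotential_eq (x : ℝ) {g : ℝ → ℝ≥0∞} (hg : Measurable g) :
    discountedPotential r g x =
      ∫⁻ y, ∫⁻ z in Ioc x y, ENNReal.ofReal (Real.exp (-(z - x))) * g z ∂volume
        ∂hazardKernel r x := by
  rw [hr.lintegral_hazardKernel_lintegral_Ioc x (by fun_prop)]
  rfl

/-- The resolvent equation. -/
theorem discountedPotential_potential_add (x : ℝ) {g : ℝ → ℝ≥0∞} (hg : Measurable g) :
    discountedPotential r (fun y => potential r g y + g y) x = potential r g x := by
  have h2 := hr.continuous_survival.measurable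
  have hSg : Measurable fun y => ENNReal.ofReal (survival r y) * g y := by fun_prop
  have hP := hr.measurable_potential hg
  have hcancel : ∀ y, ENNReal.ofReal (survival r y) *
      (ENNReal.ofReal (Real.exp (-(y - x))) * potential r g y) =
      ENNReal.ofReal (Real.exp (-(y - x))) * ∫⁻ z in Ioi y, ENNReal.ofReal (survival r z) * g z := by
    intro y
    rw [potential, mul_left_comm, ENNReal.mul_div_cancel (ofReal_survival_ne_zero y)
      ENNReal.ofReal_ne_top]
  have hm3 := measurable_lintegral_Ioi hSg
  rw [discountedPotential, potential, potential]
  congr 1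
  simp only [mul_add]
  rw [lintegral_add_left (by fun_prop)]
  simp_rw [hcancel]
  have ht := lintegral_Ioi_mul_lintegral_Ioc hSg
    (g := fun y => ENNReal.ofReal (Real.exp (-(y - x)))) (by fun_prop) x
  rw [← ht, ← lintegral_add_right _ (by fun_prop)]
  refine setLIntegral_congr_fun measurableSet_Ioi fun z hz => ?_
  have hz : x < z := hz
  rw [lintegral_Ioc_exp_neg hz.le, mul_left_comm (ENNReal.ofReal (survival r z)), mul_comm,
    ← add_mul, ← ENNReal.ofReal_add _ (Real.exp_pos _).le, sub_add_cancel, ENNReal.ofReal_one,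
    one_mul]
  rw [sub_nonneg, Real.exp_le_one_iff]
  linarith

theorem measurable_lintegral_stay (δ : ℝ) {f : ℝ → ℝ≥0∞} (hf : Measurable f) (n : ℕ) :
    Measurable fun p : ℝ × (ℕ → ℝ) =>
      ∫⁻ t, ENNReal.ofReal (Real.exp (-t)) * stay r δ f n p.1 p.2 t := by
  have h := hr.measurable_stay δ hf n
  have h' : Measurable fun q : (ℝ × (ℕ → ℝ)) × ℝ =>
      ENNReal.ofReal (Real.exp (-q.2)) * stay r δ f n q.1.1 q.1.2 q.2 :=
    Measurable.mul (by fun_prop) (h.comp (measurable_snd.prodMk measurable_fst))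
  exact h'.lintegral_prod_right'

theorem measurable_occupation (δ : ℝ) {f : ℝ → ℝ≥0∞} (hf : Measurable f) (n : ℕ) :
    Measurable (occupation r δ f n) :=
  Measurable.lintegral_prod_right' (ν := clockLaw) (hr.measurable_lintegral_stay δ hf n)

omit hr in
theorem lintegral_clockLaw {Φ : (ℕ → ℝ) → ℝ≥0∞} (hΦ : Measurable Φ) :
    ∫⁻ ξ, Φ ξ ∂clockLaw = ∫⁻ e, ∫⁻ η, Φ (consClock (e, η)) ∂clockLaw ∂(expMeasure 1) := by
  conv_lhs => rw [← map_consClock]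
  rw [lintegral_map hΦ measurable_consClock]
  exact lintegral_prod _ (hΦ.comp measurable_consClock).aemeasurable

omit hr in
theorem lintegral_stay_succ (δ x e : ℝ) (f : ℝ → ℝ≥0∞) (η : ℕ → ℝ) (n : ℕ) :
    ∫⁻ t, ENNReal.ofReal (Real.exp (-t)) * stay r δ f (n + 1) x (consClock (e, η)) t =
      ENNReal.ofReal (Real.exp (-jumpTime r x e)) *
        ∫⁻ t, ENNReal.ofReal (Real.exp (-t)) *
          stay r δ f n (δ * (x + jumpTime r x e)) η t := by
  set T := jumpTime r x e with hT
  rw [← lintegral_const_mul' _ _ ENNReal.ofReal_ne_top, ← lintegral_add_right_eq_self _ T]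
  refine lintegral_congr fun t => ?_
  rw [← mul_assoc, ← ENNReal.ofReal_mul (Real.exp_pos _).le, ← Real.exp_add, neg_add, add_comm (-t)]
  congr 1
  simp only [stay, jumpChain_consClock, ← hT, indicator, mem_Ico]
  simp only [add_comm t T, add_le_add_iff_left, add_lt_add_iff_left, add_sub_add_left_eq_sub]

theorem occupation_succ (δ : ℝ) {f : ℝ → ℝ≥0∞} (hf : Measurable f) (n : ℕ) (x : ℝ) :
    occupation r δ f (n + 1) x = discountedJump r δ (occupation r δ f n) x := by
  have hm := (hr.measurable_lintegral_stay δ hf (n + 1)).comp (measurable_prodMk_left (x := x))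
  have hm2 := hr.measurable_occupation δ hf n
  simp only [Function.comp_def] at hm
  rw [occupation, lintegral_clockLaw hm]
  rw [discountedJump, ← hr.lintegral_jumpTime x (by fun_prop)]
  refine lintegral_congr fun e => ?_
  simp_rw [lintegral_stay_succ]
  rw [lintegral_const_mul', add_sub_cancel_left]
  · rfl
  · exact ENNReal.ofReal_ne_top

theorem occupation_zero (δ : ℝ) {f : ℝ → ℝ≥0∞} (hf : Measurable f) (x : ℝ) :
    occupation r δ f 0 x = discountedPotential r f x := by
  have hm := (hr.measurable_lintegral_stay δ hf 0).comp (measurable_prodMk_left (x := x))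
  have hm2 := measurable_lintegral_Ioc
    (g := fun z => ENNReal.ofReal (Real.exp (-(z - x))) * f z) (by fun_prop) x
  simp only [Function.comp_def] at hm
  rw [occupation, lintegral_clockLaw hm, hr.discountedPotential_eq x hf,
    ← hr.lintegral_jumpTime x hm2]
  refine lintegral_congr fun e => ?_
  have h0 : ∀ η, ∫⁻ t, ENNReal.ofReal (Real.exp (-t)) * stay r δ f 0 x (consClock (e, η)) t =
      ∫⁻ z in Ioc x (x + jumpTime r x e), ENNReal.ofReal (Real.exp (-(z - x))) * f z := by
    intro η
    rw [← Measure.restrict_congr_set Ico_ae_eq_Ioc, ← lintegral_indicator measurableSet_Ico,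
      ← lintegral_sub_right_eq_self _ x]
    refine lintegral_congr fun t => ?_
    simp only [stay, jumpChain, consClock, indicator, mem_Ico, zero_add, sub_zero, mul_ite,
      mul_zero, sub_nonneg, sub_lt_iff_lt_add', add_sub_cancel]
  simp only [h0, lintegral_const, measure_univ, mul_one]

theorem lintegral_semigroup {δ : ℝ} (hδ0 : 0 ≤ δ) (hδ1 : δ ≤ 1) {μ : Measure ℝ}
    [IsProbabilityMeasure μ]
    (hμ : ∀ t : ℝ, 0 ≤ t → ∀ f : ℝ → ℝ≥0∞, Measurable f →
      ∫⁻ x, semigroup r δ t f x ∂μ = ∫⁻ x, f x ∂μ)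
    {f : ℝ → ℝ≥0∞} (hf : Measurable f) :
    ∫⁻ x, f x ∂μ = ∫⁻ x, ∑' n, occupation r δ f n x ∂μ := by
  have hmeas : ∀ n, Measurable fun p : ℝ × ℝ × (ℕ → ℝ) =>
      ENNReal.ofReal (Real.exp (-p.1)) * stay r δ f n p.2.1 p.2.2 p.1 := fun n =>
    Measurable.mul (by fun_prop) (hr.measurable_stay δ hf n)
  set Φ : ℝ × ℝ × (ℕ → ℝ) → ℝ≥0∞ := fun p =>
    ∑' n, ENNReal.ofReal (Real.exp (-p.1)) * stay r δ f n p.2.1 p.2.2 p.1 with hΦ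
  have hΦm : Measurable Φ := Measurable.tsum hmeas
  have hsx : ∀ x ξ, ∫⁻ t in Ici 0, Φ (t, x, ξ) =
      ∑' n, ∫⁻ t, ENNReal.ofReal (Real.exp (-t)) * stay r δ f n x ξ t := by
    intro x ξ
    simp only [hΦ]
    refine (lintegral_tsum fun n =>
      ((hmeas n).comp (measurable_prodMk_right (y := (x, ξ)))).aemeasurable).trans ?_
    congr 1
    funext n
    rw [← lintegral_indicator measurableSet_Ici]
    refine lintegral_congr fun t => ?_
    by_cases ht : t ∈ Ici (0 : ℝ)
    · rw [indicator_of_mem ht]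
      rfl
    · rw [indicator_of_notMem ht, stay, indicator_of_notMem, mul_zero]
      intro h
      exact ht ((hr.jumpChain_fst_nonneg δ x ξ n).trans h.1)
  calc ∫⁻ x, f x ∂μ
      = ∫⁻ t in Ici (0 : ℝ), ENNReal.ofReal (Real.exp (-t)) * ∫⁻ x, f x ∂μ := by
        rw [lintegral_mul_const _ (by fun_prop), lintegral_Ici_exp_neg, one_mul]
    _ = ∫⁻ t in Ici (0 : ℝ), ∫⁻ x, ∫⁻ ξ, Φ (t, x, ξ) ∂clockLaw ∂μ := by
        refine setLIntegral_congr_fun measurableSet_Ici fun t ht => ?_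
        rw [← hμ t ht f hf, ← lintegral_const_mul' _ _ ENNReal.ofReal_ne_top]
        refine lintegral_congr fun x => ?_
        rw [hr.semigroup_eq hδ0 hδ1 ht f x, ← lintegral_const_mul' _ _ ENNReal.ofReal_ne_top]
        refine lintegral_congr fun ξ => ?_
        rw [← ENNReal.tsum_mul_left]
    _ = ∫⁻ x, ∫⁻ t in Ici (0 : ℝ), ∫⁻ ξ, Φ (t, x, ξ) ∂clockLaw ∂volume ∂μ := by
        refine lintegral_lintegral_swap (Measurable.aemeasurable ?_)
        exact Measurable.lintegral_prod_right'
          (f := fun q : (ℝ × ℝ) × (ℕ → ℝ) => Φ (q.1.1, q.1.2, q.2)) (hΦm.comp (by fun_prop))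
    _ = ∫⁻ x, ∫⁻ ξ, ∫⁻ t in Ici (0 : ℝ), Φ (t, x, ξ) ∂volume ∂clockLaw ∂μ := by
        refine lintegral_congr fun x => lintegral_lintegral_swap (Measurable.aemeasurable ?_)
        exact hΦm.comp (by fun_prop : Measurable fun q : ℝ × (ℕ → ℝ) => (q.1, x, q.2))
    _ = ∫⁻ x, ∑' n, occupation r δ f n x ∂μ := by
        refine lintegral_congr fun x => ?_
        simp_rw [hsx]
        exact lintegral_tsum fun n =>
          ((hr.measurable_lintegral_stay δ hf n).comp measurable_prodMk_left).aemeasurable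

theorem tsum_occupation_potential_add (δ : ℝ) {g : ℝ → ℝ≥0∞} (hg : Measurable g) (x : ℝ) :
    ∑' n, occupation r δ (fun y => potential r g y + g y) n x =
      potential r g x +
        ∑' n, occupation r δ (fun y => ENNReal.ofReal (r y) * potential r g (δ * y)) n x := by
  have h1 := hr.cont.measurable
  have hP := hr.measurable_potential hg
  have hm1 : Measurable fun y => potential r g y + g y := by fun_prop
  have hm2 : Measurable fun y => ENNReal.ofReal (r y) * potential r g (δ * y) := by fun_prop
  rw [tsum_eq_zero_add' ENNReal.summable, hr.occupation_zero δ hm1,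
    hr.discountedPotential_potential_add x hg]
  congr 1
  have key : ∀ n, occupation r δ (fun y => potential r g y + g y) (n + 1) =
      occupation r δ (fun y => ENNReal.ofReal (r y) * potential r g (δ * y)) n := by
    intro n
    induction n with
    | zero =>
      funext x
      rw [hr.occupation_zero δ hm2, hr.discountedPotential_rate_mul δ x hP,
        hr.occupation_succ δ hm1]
      congr 1
      funext y
      rw [hr.occupation_zero δ hm1, hr.discountedPotential_potential_add y hg]
    | succ n ih =>
      funext x
      rw [hr.occupation_succ δ hm1, hr.occupation_succ δ hm2, ih]
  simp only [key]

theorem potential_le (x : ℝ) {g : ℝ → ℝ≥0∞} {C : ℝ≥0∞} (hg : ∀ y, g y ≤ C) :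
    potential r g x ≤ ENNReal.ofReal (1 / c) * C := by
  have h2 := hr.continuous_survival.measurable
  rw [potential]
  refine ENNReal.div_le_of_le_mul ?_
  calc ∫⁻ y in Ioi x, ENNReal.ofReal (survival r y) * g y
      ≤ ∫⁻ y in Ioi x, ENNReal.ofReal (survival r y) * C := by gcongr with y; exact hg y
    _ = (∫⁻ y in Ioi x, ENNReal.ofReal (survival r y)) * C := lintegral_mul_const _ (by fun_prop)
    _ ≤ ENNReal.ofReal (1 / c) * ENNReal.ofReal (survival r x) * C := by
        gcongr; exact hr.lintegral_survival_le x
    _ = _ := by ring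

theorem lintegral_eq_potential_of_bounded {δ : ℝ} (hδ0 : 0 ≤ δ) (hδ1 : δ ≤ 1) {μ : Measure ℝ}
    [IsProbabilityMeasure μ]
    (hμ : ∀ t : ℝ, 0 ≤ t → ∀ f : ℝ → ℝ≥0∞, Measurable f →
      ∫⁻ x, semigroup r δ t f x ∂μ = ∫⁻ x, f x ∂μ)
    {g : ℝ → ℝ≥0∞} (hg : Measurable g) {C : ℝ≥0} (hC : ∀ x, g x ≤ C) :
    ∫⁻ x, g x ∂μ = ∫⁻ x, ENNReal.ofReal (r x) * potential r g (δ * x) ∂μ := by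
  have h1 := hr.cont.measurable
  have hP := hr.measurable_potential hg
  have hm1 : Measurable fun y => potential r g y + g y := by fun_prop
  have hm2 : Measurable fun y => ENNReal.ofReal (r y) * potential r g (δ * y) := by fun_prop
  have e1 := hr.lintegral_semigroup hδ0 hδ1 hμ hm1
  simp_rw [hr.tsum_occupation_potential_add δ hg] at e1
  rw [lintegral_add_left hP, lintegral_add_left hP, ← hr.lintegral_semigroup hδ0 hδ1 hμ hm2] at e1
  refine (ENNReal.add_right_inj ?_).1 e1
  refine ne_top_of_le_ne_top (b := ENNReal.ofReal (1 / c) * C) (by finiteness) ?_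
  calc ∫⁻ x, potential r g x ∂μ ≤ ∫⁻ _, ENNReal.ofReal (1 / c) * C ∂μ :=
        lintegral_mono fun x => hr.potential_le x hC
    _ = _ := by simp

/-- An invariant law is recovered from its jumps: this is the stationarity equation in weak form. -/
theorem lintegral_eq_potential {δ : ℝ} (hδ0 : 0 ≤ δ) (hδ1 : δ ≤ 1) {μ : Measure ℝ}
    [IsProbabilityMeasure μ]
    (hμ : ∀ t : ℝ, 0 ≤ t → ∀ f : ℝ → ℝ≥0∞, Measurable f →
      ∫⁻ x, semigroup r δ t f x ∂μ = ∫⁻ x, f x ∂μ)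
    {g : ℝ → ℝ≥0∞} (hg : Measurable g) :
    ∫⁻ x, g x ∂μ = ∫⁻ x, ENNReal.ofReal (r x) * potential r g (δ * x) ∂μ := by
  have h1 := hr.cont.measurable
  have h2 := hr.continuous_survival.measurable
  set G : ℕ → ℝ → ℝ≥0∞ := fun n x => min (g x) n with hG
  have hGm : ∀ n, Measurable (G n) := fun n => hg.min measurable_const
  have hmono : Monotone G := fun m n hmn x => min_le_min_left _ (by exact_mod_cast hmn)
  have hsup : ∀ x, ⨆ n, G n x = g x := fun x => by
    have h := inf_iSup_eq (g x) fun n : ℕ => (n : ℝ≥0∞)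
    rw [ENNReal.iSup_natCast, inf_top_eq] at h
    exact h.symm
  have hpot : ∀ x, potential r g x = ⨆ n, potential r (G n) x := by
    intro x
    simp only [potential, ENNReal.div_eq_inv_mul]
    rw [← ENNReal.mul_iSup, ← lintegral_iSup (fun n => by fun_prop)]
    · simp_rw [← ENNReal.mul_iSup, hsup]
    · exact fun m n hmn y => mul_le_mul_right (hmono hmn y) _
  have hpm : ∀ x, Monotone fun n => potential r (G n) x := by
    intro x m n hmn
    simp only [potential]
    gcongr with y
    exact hmono hmn y
  calc ∫⁻ x, g x ∂μ = ⨆ n, ∫⁻ x, G n x ∂μ := by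
        rw [← lintegral_iSup hGm hmono]
        simp_rw [hsup]
    _ = ⨆ n, ∫⁻ x, ENNReal.ofReal (r x) * potential r (G n) (δ * x) ∂μ := by
        congr 1
        funext n
        exact hr.lintegral_eq_potential_of_bounded hδ0 hδ1 hμ (hGm n) (C := n)
          fun x => (min_le_right _ _).trans_eq (by simp)
    _ = _ := by
        rw [← lintegral_iSup]
        · simp_rw [← ENNReal.mul_iSup, hpot]
        · intro n
          have := hr.measurable_potential (hGm n)
          fun_prop
        · exact fun m n hmn y => mul_le_mul_right (hpm _ hmn) _

end IsIncreasingRate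

/-! ### Medians -/

theorem exists_median {ν : Measure ℝ} [IsProbabilityMeasure ν] (h0 : ν (Iio 0) = 0) {R : ℝ}
    (hR : ν.real (Ioi R) ≤ 1 / 2) :
    ∃ a ≤ R, ν.real (Iio a) ≤ 1 / 2 ∧ ν.real (Ioi a) ≤ 1 / 2 := by
  set A : Set ℝ := {x | ν.real (Ioi x) ≤ 1 / 2} with hA
  have hbdd : BddBelow A := by
    refine ⟨0, fun x hx => ?_⟩
    by_contra hlt
    have h1 : ν (Iic x) = 0 := measure_mono_null (fun y (hy : y ≤ x) => hy.trans_lt (not_le.1 hlt)) h0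
    have h2 : ν.real (Ioi x) = 1 := by
      rw [← compl_Iic, probReal_compl_eq_one_sub measurableSet_Iic, measureReal_def, h1]
      simp
    have hx : ν.real (Ioi x) ≤ 1 / 2 := hx
    linarith
  have hne : A.Nonempty := ⟨R, hR⟩
  have hup : ∀ x, sInf A < x → ν.real (Ioi x) ≤ 1 / 2 := by
    intro x hx
    obtain ⟨y, hy, hyx⟩ := exists_lt_of_csInf_lt hne hx
    exact (measureReal_mono (Ioi_subset_Ioi hyx.le)).trans hy
  have hdown : ∀ x, x < sInf A → ν.real (Iic x) ≤ 1 / 2 := by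
    intro x hx
    have h1 : ¬ ν.real (Ioi x) ≤ 1 / 2 := fun h => absurd (csInf_le hbdd h) (not_le.2 hx)
    rw [← compl_Ioi, probReal_compl_eq_one_sub measurableSet_Ioi]
    linarith [not_le.1 h1]
  set a := sInf A
  have hle : ∀ s : ℕ → Set ℝ, Monotone s → (∀ n, ν.real (s n) ≤ 1 / 2) →
      ν.real (⋃ n, s n) ≤ 1 / 2 := by
    intro s hs hb
    rw [measureReal_def, hs.measure_iUnion]
    refine ENNReal.toReal_le_of_le_ofReal (by norm_num) (iSup_le fun n => ?_)
    exact (ENNReal.le_ofReal_iff_toReal_le (measure_ne_top _ _) (by norm_num)).2 (hb n)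
  refine ⟨a, csInf_le hbdd hR, ?_, ?_⟩
  · have hU : Iio a = ⋃ n : ℕ, Iic (a - 1 / ((n : ℝ) + 1)) := by
      ext x
      simp only [mem_Iio, mem_iUnion, mem_Iic]
      constructor
      · intro hx
        obtain ⟨n, hn⟩ := exists_nat_one_div_lt (sub_pos.2 hx)
        exact ⟨n, by linarith⟩
      · rintro ⟨n, hn⟩
        have : (0 : ℝ) < 1 / ((n : ℝ) + 1) := Nat.one_div_pos_of_nat
        linarith
    rw [hU]
    refine hle _ (fun m n hmn => Iic_subset_Iic.2 ?_) fun n => hdown _ ?_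
    · have := Nat.one_div_le_one_div (α := ℝ) hmn
      linarith
    · have : (0 : ℝ) < 1 / ((n : ℝ) + 1) := Nat.one_div_pos_of_nat
      linarith
  · have hU : Ioi a = ⋃ n : ℕ, Ioi (a + 1 / ((n : ℝ) + 1)) := by
      ext x
      simp only [mem_Ioi, mem_iUnion]
      constructor
      · intro hx
        obtain ⟨n, hn⟩ := exists_nat_one_div_lt (sub_pos.2 hx)
        exact ⟨n, by linarith⟩
      · rintro ⟨n, hn⟩
        have : (0 : ℝ) < 1 / ((n : ℝ) + 1) := Nat.one_div_pos_of_nat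
        linarith
    rw [hU]
    refine hle _ (fun m n hmn => Ioi_subset_Ioi ?_) fun n => hup _ ?_
    · have := Nat.one_div_le_one_div (α := ℝ) hmn
      linarith
    · have : (0 : ℝ) < 1 / ((n : ℝ) + 1) := Nat.one_div_pos_of_nat
      linarith

theorem measureReal_Ioi_two_mul_le {ν : Measure ℝ} [IsProbabilityMeasure ν] {m : ℝ} (hm0 : 0 ≤ m)
    (hm : ∫⁻ x, ‖x‖ₑ ∂ν ≤ ENNReal.ofReal m) : ν.real (Ioi (2 * m)) ≤ 1 / 2 := by
  rcases hm0.eq_or_lt with rfl | hpos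
  · rw [ENNReal.ofReal_zero, nonpos_iff_eq_zero, lintegral_eq_zero_iff (by fun_prop)] at hm
    have : ν (Ioi (2 * 0)) = 0 := by
      refine measure_mono_null (fun x hx => ?_) hm
      have hx : 2 * 0 < x := hx
      rw [mul_zero] at hx
      simpa using hx.ne'
    rw [measureReal_def, this]
    norm_num
  · have h1 : ENNReal.ofReal (2 * m) * ν (Ioi (2 * m)) ≤ ENNReal.ofReal m := by
      refine le_trans ?_ hm
      refine le_trans ?_ (mul_meas_ge_le_lintegral (μ := ν) (f := fun x => ‖x‖ₑ) (by fun_prop)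
        (ENNReal.ofReal (2 * m)))
      gcongr
      intro x hx
      have hx : 2 * m < x := hx
      rw [mem_ofPred_eq, Real.enorm_eq_ofReal_abs]
      exact ENNReal.ofReal_le_ofReal (hx.le.trans (le_abs_self x))
    rw [← ofReal_measureReal, ← ENNReal.ofReal_mul (by positivity),
      ENNReal.ofReal_le_ofReal_iff hm0] at h1
    rw [le_div_iff₀ two_pos]
    nlinarith

/-! ### The mean jump time -/

namespace IsIncreasingRate

variable {r : ℝ → ℝ} {c : ℝ} (hr : IsIncreasingRate r c)
include hr

theorem integrableOn_survival (x : ℝ) : IntegrableOn (survival r) (Ioi x) := by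
  refine ((hr.integrableOn_rate_mul_survival x).const_mul (1 / c)).mono'
    hr.continuous_survival.aestronglyMeasurable (ae_of_all _ fun y => ?_)
  rw [Real.norm_of_nonneg (survival_pos r y).le, one_div, inv_mul_eq_div, le_div_iff₀ hr.pos,
    mul_comm]
  exact mul_le_mul_of_nonneg_right (hr.le y) (survival_pos r y).le

theorem integral_survival_pos (x : ℝ) : 0 < ∫ y in Ioi x, survival r y := by
  rw [setIntegral_pos_iff_support_of_nonneg_ae (ae_of_all _ fun y => (survival_pos r y).le)
    (hr.integrableOn_survival x)]
  have : Function.support (survival r) = univ := by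
    ext y; simp [(survival_pos r y).ne']
  rw [this, univ_inter, Real.volume_Ioi]
  exact ENNReal.zero_lt_top

theorem meanJumpTime_eq (x : ℝ) :
    meanJumpTime r x = (∫ y in Ioi x, survival r y) / survival r x := by
  rw [meanJumpTime]
  simp_rw [hr.exp_neg_cumRate]
  rw [integral_div]
  congr 1
  have := (measurePreserving_add_left volume x).setIntegral_preimage_emb
    (measurableEmbedding_addLeft x) (survival r) (Ioi x)
  rwa [preimage_const_add_Ioi, sub_self] at this

theorem meanJumpTime_pos (x : ℝ) : 0 < meanJumpTime r x := by
  rw [hr.meanJumpTime_eq]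
  exact div_pos (hr.integral_survival_pos x) (survival_pos r x)

theorem ofReal_meanJumpTime (x : ℝ) :
    ENNReal.ofReal (meanJumpTime r x) = potential r (fun _ => 1) x := by
  rw [hr.meanJumpTime_eq, ENNReal.ofReal_div_of_pos (survival_pos r x),
    ofReal_integral_eq_lintegral_ofReal (hr.integrableOn_survival x)
      (ae_of_all _ fun y => (survival_pos r y).le), potential]
  simp only [mul_one]

theorem meanJumpTime_le (x : ℝ) : meanJumpTime r x ≤ 1 / c := by
  have := hr.potential_le x (g := fun _ => 1) (C := 1) fun _ => le_rfl
  rw [← hr.ofReal_meanJumpTime, mul_one,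
    ENNReal.ofReal_le_ofReal_iff (one_div_pos.2 hr.pos).le] at this
  exact this

theorem antitone_meanJumpTime : Antitone (meanJumpTime r) := by
  intro x y hxy
  have hi : ∀ x, IntegrableOn (fun s => Real.exp (-cumRate r x s)) (Ioi 0) := by
    intro x
    simp_rw [hr.exp_neg_cumRate]
    refine Integrable.div_const ?_ _
    have := ((measurePreserving_add_left volume x).integrableOn_comp_preimage
      (measurableEmbedding_addLeft x)).2 (hr.integrableOn_survival x)
    rwa [preimage_const_add_Ioi, sub_self] at this
  refine setIntegral_mono_on (hi y) (hi x) measurableSet_Ioi fun s hs => ?_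
  rw [Real.exp_le_exp, neg_le_neg_iff]
  exact intervalIntegral.integral_mono_on (le_of_lt hs)
    ((hr.cont.comp (continuous_const.add continuous_id)).intervalIntegrable _ _)
    ((hr.cont.comp (continuous_const.add continuous_id)).intervalIntegrable _ _)
    fun u _ => hr.mono (by simpa using hxy)

theorem hasDerivAt_integral_survival (x : ℝ) :
    HasDerivAt (fun x => ∫ y in Ioi x, survival r y) (-survival r x) x := by
  have hc := hr.continuous_survival
  have heq : (fun x => ∫ y in Ioi x, survival r y) = fun x =>
      (∫ y in Ioi 0, survival r y) - ∫ y in (0 : ℝ)..x, survival r y := by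
    funext x
    rw [← intervalIntegral.integral_Ioi_sub_Ioi' (hr.integrableOn_survival 0)
      (hr.integrableOn_survival x), sub_sub_cancel]
  rw [heq]
  exact (intervalIntegral.integral_hasDerivAt_right (hc.intervalIntegrable _ _)
      hc.stronglyMeasurable.stronglyMeasurableAtFilter hc.continuousAt).const_sub _

theorem continuous_meanJumpTime : Continuous (meanJumpTime r) := by
  have : meanJumpTime r = fun x => (∫ y in Ioi x, survival r y) / survival r x :=
    funext hr.meanJumpTime_eq
  rw [this]
  exact (continuous_iff_continuousAt.2 fun x =>
    (hr.hasDerivAt_integral_survival x).continuousAt).div hr.continuous_survival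
      fun x => (survival_pos r x).ne'

theorem inv_meanJumpTime : IsIncreasingRate (fun x => (meanJumpTime r x)⁻¹) c where
  pos := hr.pos
  cont := hr.continuous_meanJumpTime.inv₀ fun x => (hr.meanJumpTime_pos x).ne'
  mono := fun x y hxy => inv_anti₀ (hr.meanJumpTime_pos y) (hr.antitone_meanJumpTime hxy)
  le := fun x => by
    rw [le_inv_comm₀ hr.pos (hr.meanJumpTime_pos x), ← one_div]
    exact hr.meanJumpTime_le x

theorem survival_inv_meanJumpTime (x : ℝ) :
    survival (fun x => (meanJumpTime r x)⁻¹) x =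
      (∫ y in Ioi x, survival r y) / ∫ y in Ioi 0, survival r y := by
  have hd : ∀ y ∈ uIcc 0 x, HasDerivAt (fun x => -Real.log (∫ y in Ioi x, survival r y))
      ((meanJumpTime r y)⁻¹) y := by
    intro y _
    refine ((hr.hasDerivAt_integral_survival y).log (hr.integral_survival_pos y).ne').neg.congr_deriv ?_
    rw [hr.meanJumpTime_eq, inv_div, neg_div, neg_neg]
  rw [survival, intervalIntegral.integral_eq_sub_of_hasDerivAt hd
    (hr.inv_meanJumpTime.cont.intervalIntegrable _ _), neg_sub, sub_neg_eq_add, neg_add_eq_sub,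
    Real.exp_sub, Real.exp_log (hr.integral_survival_pos x),
    Real.exp_log (hr.integral_survival_pos 0)]

/-- The law of the position observed at a stationary time between two jumps has hazard rate the
inverse of the mean jump time. -/
theorem potential_eq (x : ℝ) {g : ℝ → ℝ≥0∞} (hg : Measurable g) :
    potential r g x = ENNReal.ofReal (meanJumpTime r x) *
      ∫⁻ y, g y ∂hazardKernel (fun x => (meanJumpTime r x)⁻¹) x := by
  have h1 := hr.continuous_survival.measurable
  have hT := hr.integral_survival_pos
  rw [hr.inv_meanJumpTime.lintegral_hazardKernel x hg]
  have hdens : ∀ y, (meanJumpTime r y)⁻¹ * survival (fun x => (meanJumpTime r x)⁻¹) y =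
      (∫ y in Ioi 0, survival r y)⁻¹ * survival r y := by
    intro y
    rw [hr.survival_inv_meanJumpTime, hr.meanJumpTime_eq]
    have := (hT y).ne'
    have := (survival_pos r y).ne'
    have := (hT 0).ne'
    field_simp
  simp_rw [hdens, ENNReal.ofReal_mul (inv_pos.2 (hT 0)).le, mul_assoc]
  rw [lintegral_const_mul _ (by fun_prop), hr.survival_inv_meanJumpTime, potential]
  simp only [div_eq_mul_inv]
  rw [← ENNReal.ofReal_inv_of_pos (survival_pos r x), ← ENNReal.ofReal_inv_of_pos
    (mul_pos (hT x) (inv_pos.2 (hT 0)))]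
  have : ENNReal.ofReal (survival r x)⁻¹ = ENNReal.ofReal (meanJumpTime r x) *
      ENNReal.ofReal (∫ y in Ioi 0, survival r y)⁻¹ *
      ENNReal.ofReal ((∫ y in Ioi x, survival r y) * (∫ y in Ioi 0, survival r y)⁻¹)⁻¹ := by
    rw [← ENNReal.ofReal_mul (hr.meanJumpTime_pos x).le, ← ENNReal.ofReal_mul]
    · congr 1
      rw [hr.meanJumpTime_eq]
      have := (hT x).ne'
      have := (survival_pos r x).ne'
      have := (hT 0).ne'
      field_simp
    · exact mul_nonneg (hr.meanJumpTime_pos x).le (inv_pos.2 (hT 0)).le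
  rw [this]
  ring

end IsIncreasingRate

/-- `μ` is a law on `[0, ∞)` which solves the stationarity equation in weak form. -/
structure IsStationary (r : ℝ → ℝ) (δ : ℝ) (μ : Measure ℝ) : Prop where
  prob : IsProbabilityMeasure μ
  supported : μ (Iio 0) = 0
  balance : ∀ g : ℝ → ℝ≥0∞, Measurable g →
    ∫⁻ x, g x ∂μ = ∫⁻ x, ENNReal.ofReal (r x) * potential r g (δ * x) ∂μ

/-- The law of the positions after the jumps, weighted by the jump rate. -/
noncomputable def jumpFlux (r : ℝ → ℝ) (δ : ℝ) (μ : Measure ℝ) : Measure ℝ :=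
  (μ.withDensity fun x => ENNReal.ofReal (r x)).map fun x => δ * x

theorem IsStationary.ae_nonneg {r : ℝ → ℝ} {δ : ℝ} {μ : Measure ℝ} (hs : IsStationary r δ μ) :
    ∀ᵐ x ∂μ, 0 ≤ x := by
  rw [ae_iff]
  simp only [not_le]
  exact hs.supported

namespace IsIncreasingRate

variable {r : ℝ → ℝ} {c : ℝ} (hr : IsIncreasingRate r c)
include hr

theorem lintegral_jumpFlux {δ : ℝ} {μ : Measure ℝ} {g : ℝ → ℝ≥0∞} (hg : Measurable g) :
    ∫⁻ x, g x ∂jumpFlux r δ μ = ∫⁻ x, ENNReal.ofReal (r x) * g (δ * x) ∂μ := by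
  have h1 := hr.cont.measurable
  rw [jumpFlux, lintegral_map hg (by fun_prop),
    lintegral_withDensity_eq_lintegral_mul _ (by fun_prop) (by fun_prop)]
  rfl

theorem lintegral_eq_jumpFlux {δ : ℝ} {μ : Measure ℝ} (hs : IsStationary r δ μ) {g : ℝ → ℝ≥0∞}
    (hg : Measurable g) : ∫⁻ x, g x ∂μ = ∫⁻ x, potential r g x ∂jumpFlux r δ μ := by
  rw [hr.lintegral_jumpFlux (hr.measurable_potential hg), hs.balance g hg]

theorem bind_jumpFlux {δ : ℝ} {μ : Measure ℝ} (hs : IsStationary r δ μ) :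
    (jumpFlux r δ μ).bind (jumpKernel r δ) = jumpFlux r δ μ := by
  have h1 := hr.cont.measurable
  refine Measure.ext_of_lintegral _ fun g hg => ?_
  rw [Measure.lintegral_bind (jumpKernel r δ).measurable.aemeasurable hg.aemeasurable,
    hr.lintegral_jumpFlux hg, hr.lintegral_eq_jumpFlux hs (by fun_prop)]
  refine lintegral_congr fun x => ?_
  rw [lintegral_jumpKernel r δ x hg]
  exact (hr.potential_rate_mul x (g := fun y => g (δ * y)) (by fun_prop)).symm

/-- The potential of a primitive, by parts. -/
theorem potential_tail_add (x : ℝ) {φ : ℝ → ℝ≥0∞} (hφ : Measurable φ) :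
    potential r (fun y => ENNReal.ofReal (r y) * ∫⁻ z in Ioi y, φ z) x + potential r φ x =
      ∫⁻ z in Ioi x, φ z := by
  have h1 := hr.cont.measurable
  have h2 := hr.continuous_survival.measurable
  have hrS : Measurable fun y => ENNReal.ofReal (r y * survival r y) := by fun_prop
  have hI := measurable_lintegral_Ioc hrS x
  rw [hr.potential_rate_mul x (measurable_lintegral_Ioi hφ),
    hr.lintegral_hazardKernel x (measurable_lintegral_Ioi hφ),
    ← lintegral_Ioi_mul_lintegral_Ioc hφ hrS, potential, ← ENNReal.add_div,
    ← lintegral_add_left (by fun_prop)]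
  have htail : ∀ z ∈ Ioi x, φ z * (∫⁻ y in Ioc x z, ENNReal.ofReal (r y * survival r y)) +
      ENNReal.ofReal (survival r z) * φ z = ENNReal.ofReal (survival r x) * φ z := by
    intro z hz
    rw [← hr.lintegral_rate_mul_survival z, ← hr.lintegral_rate_mul_survival x, mul_comm (φ z),
      ← add_mul, ← lintegral_union measurableSet_Ioi, Ioc_union_Ioi_eq_Ioi (le_of_lt hz)]
    exact Set.disjoint_left.2 fun w hw hw' => absurd hw.2 (not_le.2 hw')
  rw [setLIntegral_congr_fun measurableSet_Ioi htail, lintegral_const_mul _ hφ,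
    mul_comm, ENNReal.mul_div_cancel_right (ofReal_survival_ne_zero x) ENNReal.ofReal_ne_top]

theorem lintegral_rate_mul_lintegral_Ioc {δ : ℝ} (hδ1 : δ ≤ 1) {μ : Measure ℝ}
    (hs : IsStationary r δ μ) {φ : ℝ → ℝ≥0∞} (hφ : Measurable φ) (hfin : ∫⁻ z, φ z ≠ ⊤) {b : ℝ}
    (hb : ∀ z, b < z → φ z = 0) :
    ∫⁻ x, ENNReal.ofReal (r x) * ∫⁻ z in Ioc (δ * x) x, φ z ∂volume ∂μ = ∫⁻ x, φ x ∂μ := by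
  have := hs.prob
  have h1 := hr.cont.measurable
  set Φ : ℝ → ℝ≥0∞ := fun y => ∫⁻ z in Ioi y, φ z with hΦ
  have hΦm : Measurable Φ := measurable_lintegral_Ioi hφ
  have hrΦ : Measurable fun y => ENNReal.ofReal (r y) * Φ y := by fun_prop
  have e1 : ∫⁻ x, ENNReal.ofReal (r x) * Φ x ∂μ + ∫⁻ x, φ x ∂μ =
      ∫⁻ x, ENNReal.ofReal (r x) * Φ (δ * x) ∂μ := by
    rw [hr.lintegral_eq_jumpFlux hs hrΦ, hr.lintegral_eq_jumpFlux hs hφ,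
      ← lintegral_add_left (hr.measurable_potential hrΦ), ← hr.lintegral_jumpFlux hΦm]
    exact lintegral_congr fun x => hr.potential_tail_add x hφ
  have e2 : ∫⁻ x, ENNReal.ofReal (r x) * Φ (δ * x) ∂μ =
      ∫⁻ x, ENNReal.ofReal (r x) * Φ x ∂μ +
        ∫⁻ x, ENNReal.ofReal (r x) * ∫⁻ z in Ioc (δ * x) x, φ z ∂volume ∂μ := by
    rw [← lintegral_add_left hrΦ]
    refine lintegral_congr_ae ?_
    filter_upwards [hs.ae_nonneg] with x hx
    have hle : δ * x ≤ x := mul_le_of_le_one_left hx hδ1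
    rw [← mul_add, add_comm, ← lintegral_union measurableSet_Ioi, Ioc_union_Ioi_eq_Ioi hle]
    exact Set.disjoint_left.2 fun w hw hw' => absurd hw.2 (not_le.2 hw')
  rw [e2] at e1
  refine ((ENNReal.add_right_inj ?_).1 e1).symm
  have hbound : ∀ x, ENNReal.ofReal (r x) * Φ x ≤ ENNReal.ofReal (r b) * ∫⁻ z, φ z := by
    intro x
    rcases le_or_gt x b with hx | hx
    · gcongr
      · exact hr.mono hx
      · exact setLIntegral_le_lintegral _ _
    · have : Φ x = 0 := by
        simp only [hΦ]
        rw [setLIntegral_congr_fun (g := 0) measurableSet_Ioi fun z (hz : x < z) => by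
          simp [hb z (hx.trans hz)]]
        simp
      simp [this]
  refine ne_top_of_le_ne_top (b := ENNReal.ofReal (r b) * ∫⁻ z, φ z) (by finiteness) ?_
  calc _ ≤ ∫⁻ _, ENNReal.ofReal (r b) * ∫⁻ z, φ z ∂volume ∂μ := lintegral_mono hbound
    _ = _ := by simp

theorem moment_le {δ : ℝ} (hδ0 : 0 ≤ δ) (hδ1 : δ ≤ 1) {μ : Measure ℝ} (hs : IsStationary r δ μ)
    (k : ℕ) :
    ∫⁻ x, ENNReal.ofReal (r x) * ENNReal.ofReal ((1 - δ ^ (k + 1)) * x ^ (k + 1)) ∂μ ≤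
      ∫⁻ x, ENNReal.ofReal ((k + 1) * x ^ k) ∂μ := by
  have := hs.prob
  have h1 := hr.cont.measurable
  set w : ℝ → ℝ≥0∞ := fun z => ENNReal.ofReal ((k + 1) * z ^ k) with hw
  have hwm : Measurable w := by fun_prop
  set ψ : ℝ → ℝ≥0∞ := fun x =>
    ENNReal.ofReal (r x) * ENNReal.ofReal ((1 - δ ^ (k + 1)) * x ^ (k + 1)) with hψ
  have hprim : ∀ x, 0 ≤ x → ∫⁻ z in Ioc (δ * x) x, w z =
      ENNReal.ofReal ((1 - δ ^ (k + 1)) * x ^ (k + 1)) := by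
    intro x hx
    have hle : δ * x ≤ x := mul_le_of_le_one_left hx hδ1
    have hc : Continuous fun z : ℝ => ((k : ℝ) + 1) * z ^ k := by fun_prop
    have hnn : ∀ᵐ z ∂(volume.restrict (Ioc (δ * x) x)), 0 ≤ ((k : ℝ) + 1) * z ^ k := by
      filter_upwards [ae_restrict_mem measurableSet_Ioc] with z hz
      have : 0 ≤ z := (mul_nonneg hδ0 hx).trans hz.1.le
      positivity
    rw [hw, ← ofReal_integral_eq_lintegral_ofReal
      (hc.integrableOn_Icc.mono_set Ioc_subset_Icc_self) hnn, ← intervalIntegral.integral_of_le hle,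
      intervalIntegral.integral_const_mul, integral_pow]
    congr 1
    have : (k : ℝ) + 1 ≠ 0 := by positivity
    field_simp
    ring
  have hstep : ∀ n : ℕ, ∫⁻ x in Ico 0 (n : ℝ), ψ x ∂μ ≤ ∫⁻ x, w x ∂μ := by
    intro n
    set φ : ℝ → ℝ≥0∞ := (Ioc 0 (n : ℝ)).indicator w with hφ
    have hφm : Measurable φ := hwm.indicator measurableSet_Ioc
    have hfin : ∫⁻ z, φ z ≠ ⊤ := by
      rw [hφ, lintegral_indicator measurableSet_Ioc]
      have hle : ∫⁻ z in Ioc 0 (n : ℝ), w z ≤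
          ∫⁻ _ in Ioc 0 (n : ℝ), ENNReal.ofReal ((k + 1) * (n : ℝ) ^ k) := by
        refine setLIntegral_mono' measurableSet_Ioc fun z hz => ENNReal.ofReal_le_ofReal ?_
        have := hz.1.le
        gcongr
        exact hz.2
      refine ne_top_of_le_ne_top ?_ hle
      rw [setLIntegral_const, Real.volume_Ioc]
      finiteness
    have key := hr.lintegral_rate_mul_lintegral_Ioc hδ1 hs hφm hfin (b := n) fun z hz =>
      indicator_of_notMem (fun h => absurd h.2 (not_le.2 hz)) _
    calc ∫⁻ x in Ico 0 (n : ℝ), ψ x ∂μ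
        = ∫⁻ x in Ico 0 (n : ℝ), ENNReal.ofReal (r x) *
            ∫⁻ z in Ioc (δ * x) x, φ z ∂volume ∂μ := by
          refine setLIntegral_congr_fun measurableSet_Ico fun x hx => ?_
          simp only [hψ]
          rw [← hprim x hx.1]
          congr 1
          refine setLIntegral_congr_fun measurableSet_Ioc fun z hz => ?_
          rw [hφ, indicator_of_mem]
          exact ⟨(mul_nonneg hδ0 hx.1).trans_lt hz.1, hz.2.trans hx.2.le⟩
      _ ≤ ∫⁻ x, ENNReal.ofReal (r x) * ∫⁻ z in Ioc (δ * x) x, φ z ∂volume ∂μ :=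
          setLIntegral_le_lintegral _ _
      _ = ∫⁻ x, φ x ∂μ := key
      _ ≤ ∫⁻ x, w x ∂μ := lintegral_mono fun x => indicator_le_self _ _ x
  have hU : (⋃ n : ℕ, Ico 0 (n : ℝ)) = Ici 0 := by
    ext x
    simp only [mem_iUnion, mem_Ico, mem_Ici]
    refine ⟨fun ⟨n, h⟩ => h.1, fun h => ?_⟩
    obtain ⟨n, hn⟩ := exists_nat_gt x
    exact ⟨n, h, hn⟩
  have hmono : Monotone fun n : ℕ => Ico 0 (n : ℝ) := fun m n hmn =>
    Ico_subset_Ico_right (by exact_mod_cast hmn)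
  calc ∫⁻ x, ψ x ∂μ = ∫⁻ x in Ici 0, ψ x ∂μ := by
        rw [Measure.restrict_eq_self_of_ae_mem]
        filter_upwards [hs.ae_nonneg] with x hx using hx
    _ = ⨆ n : ℕ, ∫⁻ x in Ico 0 (n : ℝ), ψ x ∂μ := by
        rw [← hU, setLIntegral_iUnion_of_directed _ hmono.directed_le]
    _ ≤ _ := iSup_le hstep

theorem lintegral_pow_ne_top {δ : ℝ} (hδ0 : 0 ≤ δ) (hδ1 : δ < 1) {μ : Measure ℝ}
    (hs : IsStationary r δ μ) (k : ℕ) : ∫⁻ x, ENNReal.ofReal (x ^ k) ∂μ ≠ ⊤ := by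
  have := hs.prob
  induction k with
  | zero => simp
  | succ k ih =>
    have h := hr.moment_le hδ0 hδ1.le hs k
    have hd : 0 < 1 - δ ^ (k + 1) := sub_pos.2 (pow_lt_one₀ hδ0 hδ1 (Nat.succ_ne_zero k))
    have hle : ENNReal.ofReal (c * (1 - δ ^ (k + 1))) * ∫⁻ x, ENNReal.ofReal (x ^ (k + 1)) ∂μ ≤
        ENNReal.ofReal (k + 1) * ∫⁻ x, ENNReal.ofReal (x ^ k) ∂μ := by
      rw [← lintegral_const_mul _ (by fun_prop), ← lintegral_const_mul _ (by fun_prop)]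
      refine le_trans (lintegral_mono fun x => ?_) (h.trans (lintegral_mono fun x => ?_))
      · rw [ENNReal.ofReal_mul hr.pos.le, ENNReal.ofReal_mul hd.le, mul_assoc]
        gcongr
        exact hr.le x
      · rw [ENNReal.ofReal_mul (by positivity)]
    intro htop
    rw [htop, ENNReal.mul_top (by simpa using mul_pos hr.pos hd)] at hle
    exact (ENNReal.mul_ne_top ENNReal.ofReal_ne_top ih) (top_le_iff.1 hle)

theorem lintegral_enorm_jumpFlux_le {δ : ℝ} (hδ0 : 0 ≤ δ) (hδ1 : δ < 1) {μ : Measure ℝ}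
    (hs : IsStationary r δ μ) :
    ∫⁻ x, ‖x‖ₑ ∂jumpFlux r δ μ ≤ ENNReal.ofReal (δ / (1 - δ)) := by
  have := hs.prob
  have h1 := hr.cont.measurable
  have h := hr.moment_le hδ0 hδ1.le hs 0
  simp only [zero_add, pow_one, pow_zero, Nat.cast_zero, mul_one, ENNReal.ofReal_one,
    lintegral_one, measure_univ] at h
  rw [hr.lintegral_jumpFlux (by fun_prop)]
  have hd : 0 < 1 - δ := sub_pos.2 hδ1
  calc ∫⁻ x, ENNReal.ofReal (r x) * ‖δ * x‖ₑ ∂μ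
      = ∫⁻ x, ENNReal.ofReal (δ / (1 - δ)) *
          (ENNReal.ofReal (r x) * ENNReal.ofReal ((1 - δ) * x)) ∂μ := by
        refine lintegral_congr_ae ?_
        filter_upwards [hs.ae_nonneg] with x hx
        rw [mul_left_comm, ← ENNReal.ofReal_mul (by positivity),
          Real.enorm_of_nonneg (mul_nonneg hδ0 hx)]
        congr 2
        field_simp
    _ = ENNReal.ofReal (δ / (1 - δ)) *
          ∫⁻ x, (ENNReal.ofReal (r x) * ENNReal.ofReal ((1 - δ) * x)) ∂μ :=
        lintegral_const_mul _ (by fun_prop)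
    _ ≤ ENNReal.ofReal (δ / (1 - δ)) * 1 := by gcongr
    _ = _ := mul_one _

theorem jumpFlux_univ_eq {δ : ℝ} {μ : Measure ℝ} :
    jumpFlux r δ μ univ = ∫⁻ x, ENNReal.ofReal (r x) ∂μ := by
  have := hr.lintegral_jumpFlux (δ := δ) (μ := μ) (g := fun _ => 1) measurable_const
  simpa using this

theorem le_jumpFlux_univ {δ : ℝ} {μ : Measure ℝ} (hs : IsStationary r δ μ) :
    ENNReal.ofReal c ≤ jumpFlux r δ μ univ := by
  have := hs.prob
  rw [hr.jumpFlux_univ_eq]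
  calc ENNReal.ofReal c = ∫⁻ _, ENNReal.ofReal c ∂μ := by simp
    _ ≤ _ := lintegral_mono fun x => ENNReal.ofReal_le_ofReal (hr.le x)

theorem jumpFlux_univ_ne_top {δ : ℝ} (hδ0 : 0 ≤ δ) (hδ1 : δ < 1) {μ : Measure ℝ}
    (hs : IsStationary r δ μ) : jumpFlux r δ μ univ ≠ ⊤ := by
  have := hs.prob
  have h1 := hr.cont.measurable
  rw [hr.jumpFlux_univ_eq]
  have h := hr.moment_le hδ0 hδ1.le hs 0
  simp only [zero_add, pow_one, pow_zero, Nat.cast_zero, mul_one, ENNReal.ofReal_one,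
    lintegral_one, measure_univ] at h
  have hd : 0 < 1 - δ := sub_pos.2 hδ1
  have hle : ∫⁻ x, ENNReal.ofReal (r x) ∂μ ≤ ENNReal.ofReal (r 1) + ENNReal.ofReal (1 / (1 - δ)) *
      ∫⁻ x, ENNReal.ofReal (r x) * ENNReal.ofReal ((1 - δ) * x) ∂μ := by
    rw [← lintegral_const_mul _ (by fun_prop)]
    calc ∫⁻ x, ENNReal.ofReal (r x) ∂μ ≤ ∫⁻ x, (ENNReal.ofReal (r 1) + ENNReal.ofReal (1 / (1 - δ)) *
          (ENNReal.ofReal (r x) * ENNReal.ofReal ((1 - δ) * x))) ∂μ := by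
          refine lintegral_mono fun x => ?_
          rcases le_total x 1 with hx | hx
          · exact (ENNReal.ofReal_le_ofReal (hr.mono hx)).trans le_self_add
          · refine le_trans ?_ le_add_self
            rw [mul_left_comm, ← ENNReal.ofReal_mul (by positivity)]
            refine le_mul_of_one_le_right' (ENNReal.one_le_ofReal.2 ?_)
            rw [← mul_assoc, one_div_mul_cancel hd.ne', one_mul]
            exact hx
      _ = _ := by rw [lintegral_add_left measurable_const]; simp
  refine ne_top_of_le_ne_top ?_ hle
  exact ENNReal.add_ne_top.2 ⟨ENNReal.ofReal_ne_top, ENNReal.mul_ne_top ENNReal.ofReal_ne_top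
    (ne_top_of_le_ne_top ENNReal.one_ne_top h)⟩

/-- The Poincaré inequality for stationary laws, tested on bounded functions. -/
theorem poincareBounded_of_isStationary {δ : ℝ} (hδ0 : 0 ≤ δ) (hδ1 : δ < 1) {μ : Measure ℝ}
    (hs : IsStationary r δ μ) :
    PoincareBounded μ (ENNReal.ofReal (4 / c ^ 2 + 32 * δ ^ 2 / (c ^ 3 * (1 - δ ^ 2) *
      meanJumpTime r (2 * δ / (c * (1 - δ)))))) := by
  have := hs.prob
  have hc := hr.pos
  have h1 := hr.cont.measurable
  have hhm := hr.continuous_meanJumpTime.measurable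
  set ρ := jumpFlux r δ μ with hρ
  set Z := (ρ univ).toReal with hZ
  have hρtop := hr.jumpFlux_univ_ne_top hδ0 hδ1 hs
  have hZof : ENNReal.ofReal Z = ρ univ := ENNReal.ofReal_toReal hρtop
  have hcZ : c ≤ Z := by
    have := hr.le_jumpFlux_univ hs
    rw [← hρ, ← hZof, ENNReal.ofReal_le_ofReal_iff (by positivity)] at this
    exact this
  have hZpos : 0 < Z := hc.trans_le hcZ
  have hρ0 : ρ univ ≠ 0 := by rw [← hZof]; simpa using hZpos
  set ν : Measure ℝ := (ρ univ)⁻¹ • ρ with hν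
  have hνprob : IsProbabilityMeasure ν := ⟨by
    rw [hν, Measure.smul_apply, smul_eq_mul, ENNReal.inv_mul_cancel hρ0 hρtop]⟩
  have hνint : ∀ g : ℝ → ℝ≥0∞, ∫⁻ x, g x ∂ν = (ρ univ)⁻¹ * ∫⁻ x, g x ∂ρ := fun g => by
    rw [hν, lintegral_smul_measure, smul_eq_mul]
  have hνinv : ν.bind (jumpKernel r δ) = ν := by
    refine Measure.ext_of_lintegral _ fun g hg => ?_
    rw [Measure.lintegral_bind (jumpKernel r δ).measurable.aemeasurable hg.aemeasurable,
      hνint, hνint, ← Measure.lintegral_bind (jumpKernel r δ).measurable.aemeasurable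
      hg.aemeasurable, hρ, hr.bind_jumpFlux hs]
  have hd : 0 < 1 - δ := sub_pos.2 hδ1
  have hδ2 : 0 < 1 - δ ^ 2 := by nlinarith
  set m := δ / (c * (1 - δ)) with hm
  have hm0 : 0 ≤ m := by positivity
  have hmean : ∫⁻ x, ‖x‖ₑ ∂ν ≤ ENNReal.ofReal m := by
    rw [hνint, ← hZof, ← ENNReal.ofReal_inv_of_pos hZpos]
    calc _ ≤ ENNReal.ofReal c⁻¹ * ENNReal.ofReal (δ / (1 - δ)) := by
          gcongr
          exact hr.lintegral_enorm_jumpFlux_le hδ0 hδ1 hs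
      _ = _ := by
          rw [← ENNReal.ofReal_mul (inv_pos.2 hc).le, hm]
          congr 1
          field_simp
  have hν0 : ν (Iio 0) = 0 := by
    rw [hν, Measure.smul_apply, ← lintegral_indicator_one measurableSet_Iio, hρ,
      hr.lintegral_jumpFlux (measurable_one.indicator measurableSet_Iio)]
    have : ∫⁻ x, ENNReal.ofReal (r x) * (Iio (0 : ℝ)).indicator 1 (δ * x) ∂μ = ∫⁻ _, 0 ∂μ := by
      refine lintegral_congr_ae ?_
      filter_upwards [hs.ae_nonneg] with x hx
      rw [indicator_of_notMem, mul_zero]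
      exact not_lt.2 (mul_nonneg hδ0 hx)
    rw [this]
    simp
  obtain ⟨a, haR, ha1, ha2⟩ := exists_median hν0 (measureReal_Ioi_two_mul_le hm0 hmean)
  have hPν := hr.poincareBounded_of_invariant hδ0 hδ1 hνinv
    (ne_top_of_le_ne_top ENNReal.ofReal_ne_top hmean)
  set h : ℝ → ℝ := fun x => Z * meanJumpTime r x with hh
  have hofh : ∀ x, ENNReal.ofReal (h x) = ρ univ * ENNReal.ofReal (meanJumpTime r x) := fun x => by
    rw [hh, ENNReal.ofReal_mul hZpos.le, hZof]
  have hmix : ∀ g : ℝ → ℝ≥0∞, Measurable g →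
      ∫⁻ x, ENNReal.ofReal (h x) *
        ∫⁻ y, g y ∂hazardKernel (fun x => (meanJumpTime r x)⁻¹) x ∂ν = ∫⁻ x, g x ∂μ := by
    intro g hg
    simp_rw [hofh, mul_assoc, ← hr.potential_eq _ hg]
    rw [lintegral_const_mul _ (hr.measurable_potential hg), hνint, ← mul_assoc,
      ENNReal.mul_inv_cancel hρ0 hρtop, one_mul, hr.lintegral_eq_jumpFlux hs hg]
  have hhmeas : Measurable fun x => ENNReal.ofReal (h x) := by fun_prop
  have hr' := hr.inv_meanJumpTime
  have hMk := hr'.isMarkovKernel_hazardKernel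
  have hprob : IsProbabilityMeasure (ν.withDensity fun x => ENNReal.ofReal (h x)) := ⟨by
    have := hmix (fun _ => 1) measurable_const
    rw [withDensity_apply _ MeasurableSet.univ]
    simpa using this⟩
  have hbind : (ν.withDensity fun x => ENNReal.ofReal (h x)).bind
      (hazardKernel fun x => (meanJumpTime r x)⁻¹) = μ := by
    refine Measure.ext_of_lintegral _ fun g hg => ?_
    rw [Measure.lintegral_bind (Kernel.measurable _).aemeasurable hg.aemeasurable,
      lintegral_withDensity_eq_lintegral_mul _ hhmeas hg.lintegral_kernel, ← hmix g hg]
    rfl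
  have hP := hr'.poincareBounded_bind (hPν.withDensity (h := h) (b := Z * (1 / c))
    (continuous_const.mul hr.continuous_meanJumpTime)
    (fun x y hxy => mul_le_mul_of_nonneg_left (hr.antitone_meanJumpTime hxy) hZpos.le)
    (fun x => mul_pos hZpos (hr.meanJumpTime_pos x))
    (fun x => mul_le_mul_of_nonneg_left (hr.meanJumpTime_le x) hZpos.le) ha1 ha2)
  rw [hbind] at hP
  intro F γ B L hF hB hγ hL hup
  refine (hP F γ B L hF hB hγ hL hup).trans ?_
  gcongr
  have hha : 0 < meanJumpTime r a := hr.meanJumpTime_pos a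
  have hh2 : 0 < meanJumpTime r (2 * δ / (c * (1 - δ))) := hr.meanJumpTime_pos _
  have hle : meanJumpTime r (2 * δ / (c * (1 - δ))) ≤ meanJumpTime r a := by
    refine hr.antitone_meanJumpTime (haR.trans_eq ?_)
    rw [hm, mul_div_assoc]
  rw [← ENNReal.ofReal_ofNat 3, ← ENNReal.ofReal_mul (by norm_num),
    ← ENNReal.ofReal_mul (by positivity), ← ENNReal.ofReal_add (by positivity) (by positivity)]
  refine ENNReal.ofReal_le_ofReal (add_le_add le_rfl ?_)
  calc Z * (1 / c) / (h a) * (3 * (4 * δ ^ 2 / (c ^ 2 * (1 - δ ^ 2))))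
      = 12 * δ ^ 2 / (c ^ 3 * (1 - δ ^ 2) * meanJumpTime r a) := by
        simp only [hh]
        field_simp
        ring
    _ ≤ 32 * δ ^ 2 / (c ^ 3 * (1 - δ ^ 2) * meanJumpTime r (2 * δ / (c * (1 - δ)))) := by
        gcongr
        norm_num

end IsIncreasingRate

/-! ### Extension of the jump rate to the whole line -/

/-- The extension to the line of a rate on `[0, ∞)`, constant on `(-∞, 0]`. -/
def extendRate (lam : ℝ → ℝ) (x : ℝ) : ℝ := lam (max x 0)

theorem isIncreasingRate_extendRate {lam : ℝ → ℝ} (hc : ContinuousOn lam (Ici 0))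
    (hm : MonotoneOn lam (Ici 0)) (hpos : 0 < lam 0) :
    IsIncreasingRate (extendRate lam) (lam 0) where
  pos := hpos
  cont := hc.comp_continuous (by fun_prop) fun x => le_max_right x 0
  mono := fun x y hxy =>
    hm (le_max_right x 0) (le_max_right y 0) (max_le_max_right 0 hxy)
  le := fun x => hm (mem_Ici.2 le_rfl) (le_max_right x 0) (le_max_right x 0)

theorem cumRate_extendRate (lam : ℝ → ℝ) {x t : ℝ} (hx : 0 ≤ x) (ht : 0 ≤ t) :
    cumRate (extendRate lam) x t = cumRate lam x t := by
  refine intervalIntegral.integral_congr fun u hu => ?_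
  rw [uIcc_of_le ht] at hu
  simp only [extendRate, max_eq_left (add_nonneg hx hu.1)]

theorem jumpTime_extendRate (lam : ℝ → ℝ) {x : ℝ} (hx : 0 ≤ x) (e : ℝ) :
    jumpTime (extendRate lam) x e = jumpTime lam x e := by
  rw [jumpTime, jumpTime]
  congr 1
  ext t
  exact and_congr_right fun ht => by rw [cumRate_extendRate lam hx ht]

theorem jumpTime_nonneg_of_rate (lam : ℝ → ℝ) (x e : ℝ) : 0 ≤ jumpTime lam x e :=
  Real.sInf_nonneg fun _ ht => ht.1

theorem jumpChain_extendRate (lam : ℝ → ℝ) {δ : ℝ} (hδ : 0 ≤ δ) {x : ℝ} (hx : 0 ≤ x) (ξ : ℕ → ℝ)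
    (k : ℕ) : jumpChain (extendRate lam) δ x ξ k = jumpChain lam δ x ξ k ∧
      0 ≤ (jumpChain lam δ x ξ k).2 := by
  induction k with
  | zero => exact ⟨rfl, hx⟩
  | succ k ih =>
    refine ⟨?_, ?_⟩
    · rw [jumpChain, jumpChain, ih.1, jumpTime_extendRate lam ih.2]
    · exact mul_nonneg hδ (add_nonneg ih.2 (jumpTime_nonneg_of_rate lam _ _))

theorem semigroup_extendRate (lam : ℝ → ℝ) {δ : ℝ} (hδ : 0 ≤ δ) {x : ℝ} (hx : 0 ≤ x) (t : ℝ)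
    (f : ℝ → ℝ≥0∞) : semigroup (extendRate lam) δ t f x = semigroup lam δ t f x := by
  have h : ∀ ξ k, jumpChain (extendRate lam) δ x ξ k = jumpChain lam δ x ξ k := fun ξ k =>
    (jumpChain_extendRate lam hδ hx ξ k).1
  simp only [semigroup, position, jumpCount, h]

theorem meanJumpTime_extendRate (lam : ℝ → ℝ) {x : ℝ} (hx : 0 ≤ x) :
    meanJumpTime (extendRate lam) x = meanJumpTime lam x :=
  setIntegral_congr_fun measurableSet_Ioi fun s (hs : 0 < s) => by
    simp only [cumRate_extendRate lam hx hs.le]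

theorem IsInvariantLaw.isStationary {lam : ℝ → ℝ} {δ : ℝ} (hδ0 : 0 ≤ δ) (hδ1 : δ ≤ 1)
    {μ : Measure ℝ} (hμ : IsInvariantLaw lam δ μ)
    {c : ℝ} (hr : IsIncreasingRate (extendRate lam) c) : IsStationary (extendRate lam) δ μ where
  prob := hμ.isProbabilityMeasure
  supported := hμ.supported
  balance := by
    have := hμ.isProbabilityMeasure
    have hae : ∀ᵐ x ∂μ, 0 ≤ x := by
      rw [ae_iff]
      simp only [not_le]
      exact hμ.supported
    intro g hg
    refine hr.lintegral_eq_potential hδ0 hδ1 (fun t ht f hf => ?_) hg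
    rw [← hμ.invariant t ht f hf]
    refine lintegral_congr_ae ?_
    filter_upwards [hae] with x hx
    exact semigroup_extendRate lam hδ0 hx t f

/-! ### From bounded functions to test functions -/

section TestFunction

variable {μ : Measure ℝ} [IsProbabilityMeasure μ]

omit [IsProbabilityMeasure μ] in
theorem integrable_of_polynomial_growth (h0 : ∀ᵐ x ∂μ, 0 ≤ x)
    (hmom : ∀ k : ℕ, ∫⁻ x, ENNReal.ofReal (x ^ k) ∂μ ≠ ⊤) {g : ℝ → ℝ} (hg : ContinuousOn g (Ici 0))
    {C : ℝ} {k : ℕ} (hC : ∀ x, 0 ≤ x → |g x| ≤ C * (1 + x) ^ k) : Integrable g μ := by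
  have hpow : ∀ k : ℕ, Integrable (fun x : ℝ => x ^ k) μ := by
    intro k
    refine ⟨by fun_prop, ?_⟩
    rw [hasFiniteIntegral_iff_ofReal]
    · exact (hmom k).lt_top
    · filter_upwards [h0] with x hx using pow_nonneg hx k
  have hadd : Integrable (fun x : ℝ => C * (1 + x) ^ k) μ := by
    simp_rw [add_pow, one_pow, one_mul]
    exact (integrable_finsetSum _ fun i _ => (hpow _).mul_const _).const_mul C
  refine hadd.mono' ?_ ?_
  · rw [← Measure.restrict_eq_self_of_ae_mem (s := Ici (0 : ℝ)) h0]
    exact hg.aestronglyMeasurable measurableSet_Ici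
  · filter_upwards [h0] with x hx using hC x hx

theorem isUpperGradient_truncation {f : ℝ → ℝ} (hf : ContDiffOn ℝ 1 f (Ici 0)) {b : ℝ}
    (hb : 0 ≤ b) :
    IsUpperGradient (fun x => f (max 0 (min x b))) ((Ioo 0 b).indicator fun x => ‖deriv f x‖ₑ) := by
  intro x y hxy
  set u := max 0 (min x b) with hu
  set v := max 0 (min y b) with hv
  have huv : u ≤ v := max_le_max_left _ (min_le_min_right _ hxy)
  have hu0 : 0 ≤ u := le_max_left _ _
  have hvb : v ≤ b := max_le hb (min_le_right _ _)
  have hsub : Icc u v ⊆ Ici 0 := fun z hz => hu0.trans hz.1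
  have hderiv : ∀ z, 0 < z → derivWithin f (Ici 0) z = deriv f z := fun z hz =>
    derivWithin_of_mem_nhds (Ici_mem_nhds hz)
  have hcont : ContinuousOn (derivWithin f (Ici 0)) (Icc u v) :=
    (hf.continuousOn_derivWithin (uniqueDiffOn_Ici 0) le_rfl).mono hsub
  have hFTC := intervalIntegral.integral_eq_sub_of_hasDerivAt_of_le huv (hf.continuousOn.mono hsub)
    (f' := derivWithin f (Ici 0)) (fun z hz => by
      have hz0 : 0 < z := hu0.trans_lt hz.1
      rw [hderiv z hz0]
      exact ((hf.differentiableOn one_ne_zero).differentiableAt (Ici_mem_nhds hz0)).hasDerivAt)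
    (hcont.intervalIntegrable_of_Icc huv)
  change ‖f v - f u‖ₑ ≤ _
  rw [← hFTC, intervalIntegral.integral_of_le huv]
  refine (enorm_integral_le_lintegral_enorm _).trans ?_
  rw [← Measure.restrict_congr_set Ioo_ae_eq_Ioc, setLIntegral_indicator measurableSet_Ioo,
    setLIntegral_congr_fun (g := fun z => ‖deriv f z‖ₑ) measurableSet_Ioo fun z hz => by
      simp only [hderiv z (hu0.trans_lt hz.1)]]
  refine lintegral_mono_set fun z hz => ?_
  have hz0 : 0 < z := hu0.trans_lt hz.1
  have hz1 : min x b < z := (le_max_right _ _).trans_lt hz.1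
  have hz2 : z < min y b := (lt_max_iff.1 hz.2).resolve_left (not_lt.2 hz0.le)
  have hzb : z < b := hz2.trans_le (min_le_right _ _)
  exact ⟨⟨hz0, hzb⟩, (min_lt_iff.1 hz1).resolve_right (not_lt.2 hzb.le),
    (hz2.trans_le (min_le_left _ _)).le⟩

theorem PoincareBounded.poincare {c : ℝ} (hμ : PoincareBounded μ (ENNReal.ofReal c)) (hc : 0 ≤ c)
    (h0 : ∀ᵐ x ∂μ, 0 ≤ x) (hmom : ∀ k : ℕ, ∫⁻ x, ENNReal.ofReal (x ^ k) ∂μ ≠ ⊤) :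
    Poincare μ c := by
  intro f hf
  obtain ⟨hsm, hgrowth⟩ := hf
  obtain ⟨C₀, k₀, h₀⟩ := hgrowth 0
  obtain ⟨C₁, k₁, h₁⟩ := hgrowth 1
  simp only [iteratedDerivWithin_zero] at h₀
  simp only [iteratedDerivWithin_one] at h₁
  have hf1 : ContDiffOn ℝ 1 f (Ici 0) := hsm.of_le (by exact_mod_cast le_top)
  have hcd : ContinuousOn (derivWithin f (Ici 0)) (Ici 0) :=
    hf1.continuousOn_derivWithin (uniqueDiffOn_Ici 0) le_rfl
  have hC₀ : 0 ≤ C₀ := by simpa using (abs_nonneg _).trans (h₀ 0 le_rfl)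
  have hC₁ : 0 ≤ C₁ := by simpa using (abs_nonneg _).trans (h₁ 0 le_rfl)
  have hsq : ∀ {g : ℝ → ℝ} {C : ℝ} {k : ℕ}, (∀ x, 0 ≤ x → |g x| ≤ C * (1 + x) ^ k) →
      ∀ x, 0 ≤ x → |g x ^ 2| ≤ C ^ 2 * (1 + x) ^ (k * 2) := by
    intro g C k h x hx
    rw [abs_pow, pow_mul, ← mul_pow]
    gcongr
    exact h x hx
  have hI1 := integrable_of_polynomial_growth h0 hmom hf1.continuousOn h₀
  have hI2 : Integrable (fun x => f x ^ 2) μ := integrable_of_polynomial_growth h0 hmom (hf1.continuousOn.pow 2) (hsq h₀)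
  have hI3 : Integrable (fun x => derivWithin f (Ici 0) x ^ 2) μ := integrable_of_polynomial_growth h0 hmom (hcd.pow 2) (hsq h₁)
  refine ⟨hI1, hI2, hI3, ?_⟩
  set p : ℕ → ℝ → ℝ := fun n x => max 0 (min x n) with hp
  have hp0 : ∀ n x, 0 ≤ p n x := fun n x => le_max_left _ _
  have hpn : ∀ n x, p n x ≤ n := fun n x => max_le n.cast_nonneg (min_le_right _ _)
  have hpx : ∀ n x, 0 ≤ x → p n x ≤ x := fun n x hx => max_le hx (min_le_left _ _)
  set F : ℕ → ℝ → ℝ := fun n x => f (p n x) with hF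
  have hFc : ∀ n, Continuous (F n) := fun n =>
    hf1.continuousOn.comp_continuous (by fun_prop) fun x => hp0 n x
  have hFB : ∀ n x, |F n x| ≤ C₀ * (1 + n) ^ k₀ := fun n x => by
    refine (h₀ _ (hp0 n x)).trans ?_
    have := hp0 n x
    gcongr
    exact hpn n x
  have hFdom : ∀ n x, 0 ≤ x → |F n x| ≤ C₀ * (1 + x) ^ k₀ := fun n x hx => by
    refine (h₀ _ (hp0 n x)).trans ?_
    have := hp0 n x
    gcongr
    exact hpx n x hx
  have hderiv : ∀ z, 0 < z → derivWithin f (Ici 0) z = deriv f z := fun z hz =>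
    derivWithin_of_mem_nhds (Ici_mem_nhds hz)
  have hvar : ∀ n, Var[F n; μ] ≤ c * ∫ x, derivWithin f (Ici 0) x ^ 2 ∂μ := by
    intro n
    set γ : ℝ → ℝ≥0∞ := (Ioo 0 (n : ℝ)).indicator fun x => ‖deriv f x‖ₑ with hγ
    have hγm : Measurable γ := (measurable_deriv f).enorm.indicator measurableSet_Ioo
    have hγL : ∀ x, γ x ≤ ((C₁ * (1 + n) ^ k₁).toNNReal : ℝ≥0) := by
      intro x
      by_cases hx : x ∈ Ioo 0 (n : ℝ)
      · rw [hγ, indicator_of_mem hx, Real.enorm_eq_ofReal_abs, ← hderiv x hx.1]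
        refine ENNReal.ofReal_le_ofReal ((h₁ x hx.1.le).trans ?_)
        have := hx.1.le
        gcongr
        exact hx.2.le
      · rw [hγ, indicator_of_notMem hx]
        exact zero_le
    have key := hμ (F n) γ _ _ (hFc n) (hFB n) hγm hγL
      (isUpperGradient_truncation hf1 n.cast_nonneg)
    have hγ2 : ∫⁻ x, γ x ^ 2 ∂μ ≤ ENNReal.ofReal (∫ x, derivWithin f (Ici 0) x ^ 2 ∂μ) := by
      rw [ofReal_integral_eq_lintegral_ofReal hI3 (ae_of_all _ fun x => sq_nonneg _)]
      refine lintegral_mono fun x => ?_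
      by_cases hx : x ∈ Ioo 0 (n : ℝ)
      · rw [hγ, indicator_of_mem hx, hderiv x hx.1, ← sq_abs (deriv f x),
          ENNReal.ofReal_pow (abs_nonneg _), ← Real.enorm_eq_ofReal_abs]
      · rw [hγ, indicator_of_notMem hx]
        simp
    have hnn : 0 ≤ ∫ x, derivWithin f (Ici 0) x ^ 2 ∂μ := integral_nonneg fun x => sq_nonneg _
    rw [← ENNReal.ofReal_le_ofReal_iff (mul_nonneg hc hnn), ENNReal.ofReal_mul hc]
    exact key.trans (by gcongr)
  have hdomI : Integrable (fun x : ℝ => C₀ * (1 + x) ^ k₀) μ :=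
    integrable_of_polynomial_growth h0 hmom (by fun_prop) (C := C₀) (k := k₀) fun x hx => by
      rw [abs_of_nonneg (by positivity)]
  have hdomI2 : Integrable (fun x : ℝ => C₀ ^ 2 * (1 + x) ^ (k₀ * 2)) μ :=
    integrable_of_polynomial_growth h0 hmom (by fun_prop) (C := C₀ ^ 2) (k := k₀ * 2) fun x hx => by
      rw [abs_of_nonneg (by positivity)]
  have hlimp : ∀ x, 0 ≤ x → ∀ᶠ n in atTop, F n x = f x := by
    intro x hx
    obtain ⟨N, hN⟩ := exists_nat_ge x
    filter_upwards [eventually_ge_atTop N] with n hn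
    have : x ≤ n := hN.trans (by exact_mod_cast hn)
    simp only [hF, hp, min_eq_left this, max_eq_right hx]
  have hlim1 : Tendsto (fun n => ∫ x, F n x ∂μ) atTop (𝓝 (∫ x, f x ∂μ)) := by
    refine tendsto_integral_of_dominated_convergence _ (fun n => (hFc n).aestronglyMeasurable)
      hdomI (fun n => ?_) ?_
    · filter_upwards [h0] with x hx using hFdom n x hx
    · filter_upwards [h0] with x hx
      exact tendsto_const_nhds.congr' ((hlimp x hx).mono fun n hn => hn.symm)
  have hlim2 : Tendsto (fun n => ∫ x, F n x ^ 2 ∂μ) atTop (𝓝 (∫ x, f x ^ 2 ∂μ)) := by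
    refine tendsto_integral_of_dominated_convergence _
      (fun n => ((hFc n).pow 2).aestronglyMeasurable) hdomI2 (fun n => ?_) ?_
    · filter_upwards [h0] with x hx using hsq (hFdom n) x hx
    · filter_upwards [h0] with x hx
      exact tendsto_const_nhds.congr' ((hlimp x hx).mono fun n hn => by simp only [hn])
  refine le_of_tendsto' (hlim2.sub (hlim1.pow 2)) fun n => ?_
  refine le_trans (le_of_eq ?_) (hvar n)
  rw [variance_eq_sub (memLp_two_of_bounded (hFc n).measurable (hFB n))]
  rfl

end TestFunction

end TCP

theorem corollary4p5 (lam : ℝ → ℝ) (lamStar δ : ℝ) (κ : ℝ≥0) (μ : Measure ℝ)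
    (hδ0 : 0 ≤ δ) (hδ1 : δ < 1)
    (hsmooth : ContDiffOn ℝ ∞ lam (Ici 0))
    (hmono : MonotoneOn lam (Ici 0))
    (hlam0 : lam 0 = lamStar) (hpos : 0 < lamStar)
    (hlip : LipschitzOnWith κ (fun x => Real.log (lam x)) (Ici 0))
    (hμ : TCP.IsInvariantLaw lam δ μ) :
    TCP.Poincare μ
      (4 / lamStar ^ 2 +
        32 * δ ^ 2 / (lamStar ^ 3 * (1 - δ ^ 2) *
          TCP.meanJumpTime lam (2 * δ / (lamStar * (1 - δ))))) := by
  subst hlam0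
  have hr := TCP.isIncreasingRate_extendRate hsmooth.continuousOn hmono hpos
  have hs := hμ.isStationary hδ0 hδ1.le hr
  have := hs.prob
  have hP := hr.poincareBounded_of_isStationary hδ0 hδ1 hs
  have hd : 0 < 1 - δ := sub_pos.2 hδ1
  have hd2 : 0 < 1 - δ ^ 2 := by nlinarith
  rw [TCP.meanJumpTime_extendRate lam (by positivity)] at hP
  have hh := hr.meanJumpTime_pos (2 * δ / (lam 0 * (1 - δ)))
  rw [TCP.meanJumpTime_extendRate lam (by positivity)] at hh
  exact hP.poincare (by positivity) hs.ae_nonneg (hr.lintegral_pow_ne_top hδ0 hδ1 hs)
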